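/- For a permutation $\sigma$ of $\{1,\dots,m\}$, a permutation $\pi$ of $\{1,\dots,n\}$ contains $\sigma$ if there are indices $i_1<\dots<i_m$ such that for all $j<k$, $\pi(i_j)<\pi(i_k)$ if and only if $\sigma(j)<\sigma(k)$; otherwise $\pi$ avoids $\sigma$. Let $\mathcal I_n(\sigma)$ be the set of involutions of $\{1,\dots,n\}$ (permutations with $\pi\circ\pi=\mathrm{id}$) that avoid $\sigma$, let $\mathrm{fp}(\pi)$ be the number of fixed points of $\pi$, and for $q>0$ let $\mathbb P^{q,\sigma}_n$ be the probability measure on $\mathcal I_n(\sigma)$ with $\mathbb P^{q,\sigma}_n(\pi)\propto q^{\mathrm{fp}(\pi)}$. Fix $\sigma\in\{321,132,213\}$ and $q>0$, and for each $n$ let $\Pi_n$ be a random element of $\mathcal I_n(\sigma)$ with law $\mathbb P^{q,\sigma}_n$. Write $\to_d$ for convergence in distribution as $n\to\infty$. 1. If $0<q<1$, then $\mathrm{fp}(\Pi_{2n})\to_d N_1$ and $\mathrm{fp}(\Pi_{2n+1})\to_d N_2$, where $N_1$ and $N_2$ have the law of a Negative Binomial random variable $N$ with parameters $r=2$ and $p=1-q$,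 that is, $\mathbb P(N=k)=(k+1)q^k(1-q)^2$ for $k\ge 0$, conditioned to be even and conditioned to be odd, respectively. 2. If $q=1$, then $$\sqrt{\tfrac1n}\,\mathrm{fp}(\Pi_n)\to_d \tfrac1{\sqrt2}X_2,$$ where $X_2=\Lambda_1-\Lambda_2$ and $\Lambda_1\ge\Lambda_2$ are the eigenvalues of a random matrix from the $2\times2$ Gaussian Orthogonal Ensemble (symmetric matrices with density proportional to $e^{-\mathrm{tr}(M^2)/2}$, i.e. independent centered normal entries on and above the diagonal, of variance $1$ on the diagonal and $1/2$ off it) conditioned to have trace $0$. Moreover $X_2/\sqrt2$ has the Rayleigh$(1)$ distribution, with density $x e^{-x^2/2}$ on $(0,\infty)$. 3. If $q>1$, then $$\frac{\mathrm{fp}(\Pi_n)-\frac{q^2-1}{q^2+1}\,n}{\sqrt{\frac{4q^2}{(q^2+1)^2}\,n}}\to_d Z,$$ where $Z$ has the standard normal distribution. -/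

import Mathlib

open MeasureTheory ProbabilityTheory Filter Topology

noncomputable section

namespace FixedPointBias

/-! ### Pattern-avoiding involutions -/

/-- `π` contains the pattern `σ`: some subsequence of `π` is in the same relative order as `σ`. -/
def Contains {n m : ℕ} (π : Equiv.Perm (Fin n)) (σ : Equiv.Perm (Fin m)) : Prop :=
  ∃ i : Fin m → Fin n, StrictMono i ∧
    ∀ j k : Fin m, j < k → (π (i j) < π (i k) ↔ σ j < σ k)

/-- The involutions of `{0, …, n - 1}` that avoid the pattern `σ`. -/
def AvoidingInvolution {m : ℕ} (σ : Equiv.Perm (Fin m)) (n : ℕ) : Type :=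
  {π : Equiv.Perm (Fin n) // (∀ x, π (π x) = x) ∧ ¬ Contains π σ}

instance {m : ℕ} (σ : Equiv.Perm (Fin m)) (n : ℕ) : Finite (AvoidingInvolution σ n) :=
  Subtype.finite

instance {m : ℕ} (σ : Equiv.Perm (Fin m)) (n : ℕ) : Fintype (AvoidingInvolution σ n) :=
  Fintype.ofFinite _

instance {m : ℕ} (σ : Equiv.Perm (Fin m)) (n : ℕ) :
    MeasurableSpace (AvoidingInvolution σ n) := ⊤

/-- The number of fixed points. -/
def fp {m n : ℕ} {σ : Equiv.Perm (Fin m)} (π : AvoidingInvolution σ n) : ℕ :=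
  (Finset.univ.filter fun x : Fin n => π.1 x = x).card

/-- The probability measure on the `σ`-avoiding involutions of length `n` that gives `π` a mass
proportional to `q ^ fp π`. -/
def biasedMeasure {m : ℕ} (q : ℝ) (σ : Equiv.Perm (Fin m)) (n : ℕ) :
    Measure (AvoidingInvolution σ n) :=
  ∑ π : AvoidingInvolution σ n,
    ENNReal.ofReal (q ^ fp π / ∑ τ : AvoidingInvolution σ n, q ^ fp τ) • Measure.dirac π

/-- The pattern `321`, in one-line notation on `{0, 1, 2}`. -/
def pattern321 : Equiv.Perm (Fin 3) := ⟨![2, 1, 0], ![2, 1, 0], by decide, by decide⟩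

/-- The pattern `132`, in one-line notation on `{0, 1, 2}`. -/
def pattern132 : Equiv.Perm (Fin 3) := ⟨![0, 2, 1], ![0, 2, 1], by decide, by decide⟩

/-- The pattern `213`, in one-line notation on `{0, 1, 2}`. -/
def pattern213 : Equiv.Perm (Fin 3) := ⟨![1, 0, 2], ![1, 0, 2], by decide, by decide⟩

/-! ### Limit laws -/

/-- The negative binomial law with parameters `r` and `p`: the number of failures before the
`r`-th success (`r ≥ 1`) in independent trials with success probability `p`. -/
def negBinomial (r : ℕ) (p : ℝ) : Measure ℕ :=
  Measure.sum fun k : ℕ =>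
    ENNReal.ofReal ((k + r - 1).choose k * (1 - p) ^ k * p ^ r) • Measure.dirac k

/-- The Rayleigh law with scale parameter `s`. -/
def rayleigh (s : ℝ) : Measure ℝ :=
  volume.withDensity fun x =>
    ENNReal.ofReal (if 0 < x then x / s ^ 2 * Real.exp (-x ^ 2 / (2 * s ^ 2)) else 0)

/-! ### The Gaussian Orthogonal Ensemble conditioned to have trace zero -/

/-- The law of a `k × k` array of independent standard normal variables. -/
def gaussianArray (k : ℕ) : Measure (Fin k × Fin k → ℝ) :=
  Measure.pi fun _ => gaussianReal 0 1

/-- The `k × k` Gaussian Orthogonal Ensemble, as a random matrix on the probability space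
`gaussianArray k`: a symmetric matrix with independent centered normal entries on and above the
diagonal, of variance `1` on the diagonal and `1 / 2` off it (density proportional to
`exp (-tr M² / 2)`). -/
def goe (k : ℕ) (g : Fin k × Fin k → ℝ) : Matrix (Fin k) (Fin k) ℝ :=
  Matrix.of fun i j => (g (i, j) + g (j, i)) / 2

/-- The Gaussian Orthogonal Ensemble conditioned to have trace `0`. Since the trace and the
traceless part of a GOE matrix are independent (`indepFun_trace_goeTraceZero`), the conditional
law of the matrix given that its trace is `t` is the law of its traceless part plus `(t / k) • 1`;
at `t = 0` it is the law of the traceless part. -/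
def goeTraceZero (k : ℕ) (g : Fin k × Fin k → ℝ) : Matrix (Fin k) (Fin k) ℝ :=
  goe k g - ((goe k g).trace / k) • (1 : Matrix (Fin k) (Fin k) ℝ)

theorem indepFun_trace_goeTraceZero (k : ℕ) :
    IndepFun (fun g => (goe k g).trace) (fun g (p : Fin k × Fin k) => goeTraceZero k g p.1 p.2)
      (gaussianArray k) := by
  have hind : iIndepFun (fun (p : Fin k × Fin k) (g : Fin k × Fin k → ℝ) => g p)
      (gaussianArray k) :=
    iIndepFun_pi (X := fun _ => id) (fun _ => aemeasurable_id)
  have hlaw : ∀ p : Fin k × Fin k,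
      HasLaw (fun g : Fin k × Fin k → ℝ => g p) (gaussianReal 0 1) (gaussianArray k) := fun p =>
    (measurePreserving_eval (fun _ : Fin k × Fin k => gaussianReal 0 1) p).hasLaw
  have hG : HasGaussianLaw (fun g : Fin k × Fin k → ℝ => fun p => g p) (gaussianArray k) :=
    hind.hasGaussianLaw fun p => (hlaw p).hasGaussianLaw
  have hP : IsProbabilityMeasure (gaussianArray k) := hG.isProbabilityMeasure
  have hL : ∀ p, MemLp (fun g : Fin k × Fin k → ℝ => g p) 2 (gaussianArray k) := fun p =>
    (hlaw p).hasGaussianLaw.memLp_two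
  have hcov : ∀ p r : Fin k × Fin k,
      cov[fun g : Fin k × Fin k → ℝ => g p, fun g => g r; gaussianArray k] =
        if p = r then 1 else 0 := by
    intro p r
    split_ifs with h
    · subst h
      rw [covariance_self (hlaw p).aemeasurable, (hlaw p).variance_eq, variance_id_gaussianReal]
      rfl
    · exact (hind.indepFun h).covariance_eq_zero (hL p) (hL r)
  have htr : ∀ g, (goe k g).trace = ∑ i, g (i, i) := fun g => by
    simp [goe, Matrix.trace]
  have hT : MemLp (fun g : Fin k × Fin k → ℝ => ∑ i, g (i, i)) 2 (gaussianArray k) :=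
    memLp_finsetSum _ fun i _ => hL (i, i)
  let L : (Fin k × Fin k → ℝ) →ₗ[ℝ] (Unit → ℝ) × (Fin k × Fin k → ℝ) :=
    { toFun := fun g => (fun _ => (goe k g).trace, fun p => goeTraceZero k g p.1 p.2)
      map_add' := fun g h => by
        ext p
        · simp [htr, Finset.sum_add_distrib]
        · simp [goeTraceZero, htr, Finset.sum_add_distrib]; simp [goe]; ring
      map_smul' := fun c g => by
        ext p
        · simp [htr, Finset.mul_sum]
        · simp [goeTraceZero, htr, ← Finset.mul_sum]; simp [goe]; ring }
  have hpair := hG.map_fun (LinearMap.toContinuousLinearMap L)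
  have key := HasGaussianLaw.indepFun_of_covariance_eval
    (X := fun (_ : Unit) g => (goe k g).trace)
    (Y := fun (p : Fin k × Fin k) g => goeTraceZero k g p.1 p.2) hpair ?_
  · exact key.comp (φ := fun f : Unit → ℝ => f ()) (ψ := id) (measurable_pi_apply ()) measurable_id
  rintro - ⟨i, j⟩
  have hk : (k : ℝ) ≠ 0 := by have := i.pos; positivity
  have e : (fun g => goeTraceZero k g i j) = fun g : Fin k × Fin k → ℝ =>
      (2⁻¹ * g (i, j) + 2⁻¹ * g (j, i)) -
        ((1 : Matrix (Fin k) (Fin k) ℝ) i j / k) * ∑ l, g (l, l) := by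
    funext g
    simp only [goeTraceZero, Matrix.sub_apply, Matrix.smul_apply, htr, smul_eq_mul]
    simp [goe]
    ring
  simp only [htr]
  have hA : MemLp (fun g : Fin k × Fin k → ℝ => 2⁻¹ * g (i, j) + 2⁻¹ * g (j, i)) 2
      (gaussianArray k) := ((hL _).const_mul _).add ((hL _).const_mul _)
  rw [e, covariance_fun_sub_right hT hA (hT.const_mul _)]
  have e2 : cov[fun g : Fin k × Fin k → ℝ => ∑ i, g (i, i),
      fun g => 2⁻¹ * g (i, j) + 2⁻¹ * g (j, i); gaussianArray k] =
      (1 : Matrix (Fin k) (Fin k) ℝ) i j := by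
    have := covariance_add_right hT ((hL (i,j)).const_mul 2⁻¹) ((hL (j,i)).const_mul 2⁻¹)
    refine this.trans ?_
    rw [covariance_const_mul_right, covariance_const_mul_right,
      covariance_fun_sum_left (fun l => hL (l, l)) (hL _),
      covariance_fun_sum_left (fun l => hL (l, l)) (hL _)]
    simp only [hcov, Prod.mk.injEq, Matrix.one_apply]
    by_cases h : i = j
    · subst h; simp; norm_num
    · have h1 : ∀ l, ¬ (l = i ∧ l = j) := fun l hl => h (hl.1.symm.trans hl.2)
      have h2 : ∀ l, ¬ (l = j ∧ l = i) := fun l hl => h (hl.2.symm.trans hl.1)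
      simp [h, h1, h2]
  have e3 : cov[fun g : Fin k × Fin k → ℝ => ∑ i, g (i, i),
      fun g => ∑ i, g (i, i); gaussianArray k] = k := by
    rw [covariance_fun_sum_fun_sum (fun l => hL (l, l)) (fun l => hL (l, l))]
    simp [hcov]
  rw [e2, covariance_const_mul_right, e3]
  field_simp
  simp

/-- `Λ₁ - Λ₂ + Λ₃ - ⋯ ± Λ_k`, where `Λ₁ ≥ ⋯ ≥ Λ_k` are the eigenvalues of the symmetric matrix
`M`, with multiplicity. (For a matrix that is not symmetric the value is `0`.) -/
def altEigenvalueSum {k : ℕ} (M : Matrix (Fin k) (Fin k) ℝ) : ℝ :=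
  open Classical in
  if h : M.IsHermitian then
    ∑ j : Fin k, (-1) ^ (j : ℕ) * h.eigenvalues₀ (Fin.cast (Fintype.card_fin k).symm j)
  else 0

/-- The law of the alternating sum `S` of the ordered eigenvalues of the `k × k` Gaussian
Orthogonal Ensemble conditioned to have trace `0`. -/
def lawS (k : ℕ) : Measure ℝ :=
  (gaussianArray k).map fun g => altEigenvalueSum (goeTraceZero k g)

/-- The law of `X`: the law of `S`, reweighted by the density `q ^ s / E[q ^ S]`. -/
def lawX (k : ℕ) (q : ℝ) : Measure ℝ :=
  (lawS k).withDensity fun s => ENNReal.ofReal (q ^ s / ∫ t, q ^ t ∂lawS k)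

/-! ### Convergence in distribution -/

/-- The random variables `X n`, each on its own probability space, converge in distribution to
the law `ν`; part of the claim is that `ν` is a probability measure. -/
def ConvergesInLaw {E : Type*} [TopologicalSpace E] [MeasurableSpace E] [OpensMeasurableSpace E]
    {Ω : ℕ → Type*} [∀ n, MeasurableSpace (Ω n)] (P : ∀ n, Measure (Ω n))
    [∀ n, IsProbabilityMeasure (P n)] (X : ∀ n, Ω n → E) (ν : Measure E) : Prop :=
  ∃ _ : IsProbabilityMeasure ν, TendstoInDistribution X atTop id P ν

end FixedPointBias

end

open MeasureTheory ProbabilityTheory Filter Topology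

noncomputable section

namespace FixedPointBias

/-! All three limit laws come from one enumeration: for each of the three patterns, the avoiding
involutions of `n` points with `k` fixed points are counted by `ballot n k`. By the reflection
identity `ballot_add_choose` this is `C(n, i) - C(n, i - 1)` for `k = n - 2i`, and it vanishes when
`n - k` is odd.

Enumeration. For 321, the points are read from right to left, with `H` the set of closers whose
partners are still to come. Avoidance forbids a fixed point under an arc and forbids nested arcs, so
a fixed point is possible only if `H` is empty, and an opener must take the largest element of `H`.
Hence `H.card` plus the number of remaining fixed points makes a nonnegative walk with steps `±1`,
with exactly one configuration per walk. For 132, the last point is fixed and can be deleted, or its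
arc can be traded bijectively for one fixed point (`closeLast`); both moves together are the
recurrence of `ballot`. Reversal and complementation carry 132 to 213.

Asymptotics. For `q < 1`, `ballot_mul` makes the weight of `k` fixed points proportional to `(k + 1)
q ^ k` times a ratio of near-central binomial coefficients, which is at most 1 and tends to 1;
dominated convergence yields the negative binomial law on one parity class. For `q = 1` the
differences of binomials telescope, so a tail probability is one ratio of binomial coefficients,
with limit `exp (-x² / 2)`, the Rayleigh tail; the eigenvalue gap divided by `√2` is the length of a
planar standard Gaussian vector, which has the same law. For `q > 1` the generating function `∑
ballot n (n - 2i) u ^ i` equals `(1 - u) (1 + u) ^ n` up to an exponentially smaller error, so the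
characteristic function of the number of fixed points is asymptotically that of a biased `±1` walk,
and the central limit theorem applies. -/

/-- The number of paths of length `n` with steps `±1` that start at `0`, stay nonnegative and end
at `k`. -/
def ballot : ℕ → ℕ → ℕ
  | 0, k => if k = 0 then 1 else 0
  | n + 1, 0 => ballot n 1
  | n + 1, k + 1 => ballot n k + ballot n (k + 2)

/-! ### Counting the involutions that avoid `321` -/

/-- The involutions of `{0, …, n - 1} ∪ H` (extended by the identity) that avoid `321`, send every
element of `H` to a smaller one, and have `k` fixed points. -/
def involutions321 (n : ℕ) (H : Finset ℕ) (k : ℕ) : Set (Equiv.Perm ℕ) :=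
  {f | (∀ x, f (f x) = x) ∧ (∀ x, n ≤ x → x ∉ H → f x = x) ∧
    (∀ a b c, (a < n ∨ a ∈ H) → (b < n ∨ b ∈ H) → (c < n ∨ c ∈ H) → a < b → b < c →
      f b < f a → f c < f b → False) ∧
    (∀ x ∈ H, f x < x) ∧ ((Finset.range n).filter fun x => f x = x).card = k}

/-- With no low points left, the minimum of a nonempty `H` has no smaller partner available. -/
theorem involutions321_zero (H : Finset ℕ) (k : ℕ) :
    (involutions321 0 H k).encard = ballot 0 (H.card + k) := by
  rcases H.eq_empty_or_nonempty with rfl | hH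
  · rcases Nat.eq_zero_or_pos k with rfl | hk
    · have : involutions321 0 ∅ 0 = {1} := by
        ext f
        simp only [involutions321, Set.mem_ofPred_eq, Set.mem_singleton_iff]
        constructor
        · rintro ⟨-, h, -⟩
          ext x
          simpa using h x (Nat.zero_le _) (by simp)
        · rintro rfl
          simp
      simp [this, ballot]
    · have : involutions321 0 ∅ k = ∅ := by
        ext f
        simp [involutions321]
        intros; omega
      simp [this, ballot, hk.ne']
  · have : involutions321 0 H k = ∅ := by
      ext f
      simp only [involutions321, Set.mem_ofPred_eq, Set.mem_empty_iff_false, iff_false]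
      rintro ⟨h1, h2, -, h3, -⟩
      have hm := H.min'_mem hH
      have h4 := h3 _ hm
      have h5 : f (H.min' hH) ∉ H := fun h => by
        have := H.min'_le _ h
        omega
      have h6 := h2 _ (Nat.zero_le _) h5
      rw [h1] at h6
      omega
    have hc : H.card ≠ 0 := by simpa using hH.ne_empty
    simp [this, ballot, hc]

/-- If `n` is a closer, it satisfies the condition imposed on `H`; it merely passes from the initial
segment to `H`, and the permutations are unchanged. -/
theorem involutions321_closer (n : ℕ) (H : Finset ℕ) (k : ℕ) :
    {f ∈ involutions321 (n + 1) H k | f n < n} = involutions321 n (insert n H) k := by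
  ext f
  simp only [involutions321, Set.mem_ofPred_eq, Finset.mem_insert]
  constructor
  · rintro ⟨⟨h1, h2, h3, h4, h5⟩, h⟩
    refine ⟨h1, fun x hx hxH => h2 x (by grind) (by grind), ?_, by grind, ?_⟩
    · intro a b c ha hb hc
      exact h3 a b c (by grind) (by grind) (by grind)
    · rw [← h5, Finset.range_add_one, Finset.filter_insert, if_neg h.ne]
  · rintro ⟨h1, h2, h3, h4, h5⟩
    have h := h4 n (Or.inl rfl)
    refine ⟨⟨h1, fun x hx hxH => h2 x (by grind) (by grind), ?_, by grind, ?_⟩, h⟩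
    · intro a b c ha hb hc
      exact h3 a b c (by grind) (by grind) (by grind)
    · rw [← h5, Finset.range_add_one, Finset.filter_insert, if_neg h.ne]

theorem involutions321_fixed_empty (n k : ℕ) :
    {f ∈ involutions321 (n + 1) ∅ (k + 1) | f n = n} = involutions321 n ∅ k := by
  ext f
  simp only [involutions321, Set.mem_ofPred_eq, Finset.notMem_empty, or_false]
  constructor
  · rintro ⟨⟨h1, h2, h3, h4, h5⟩, h⟩
    refine ⟨h1, fun x hx hxH => ?_, ?_, by grind, ?_⟩
    · rcases hx.eq_or_lt with rfl | hx
      · exact h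
      · exact h2 x hx (by simp)
    · intro a b c ha hb hc
      exact h3 a b c (by lia) (by lia) (by lia)
    · rw [Finset.range_add_one, Finset.filter_insert, if_pos h,
        Finset.card_insert_of_notMem (by simp)] at h5
      lia
  · rintro ⟨h1, h2, h3, h4, h5⟩
    have h := h2 n le_rfl (by simp)
    refine ⟨⟨h1, fun x hx hxH => h2 x (by lia) (by simp), ?_, by simp, ?_⟩, h⟩
    · intro a b c ha hb hc hab hbc h6 h7
      by_cases hcn : c = n
      · subst hcn
        rw [h] at h7
        have h8 := h2 (f b) h7.le (by simp)
        rw [h1] at h8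
        lia
      · exact h3 a b c (by lia) (by lia) (by lia) hab hbc h6 h7
    · rw [Finset.range_add_one, Finset.filter_insert, if_pos h,
        Finset.card_insert_of_notMem (by simp), h5]

theorem involutions321_fixed_zero (n : ℕ) (H : Finset ℕ) :
    {f ∈ involutions321 (n + 1) H 0 | f n = n} = ∅ := by
  ext f
  simp only [involutions321, Set.mem_ofPred_eq, Set.mem_empty_iff_false, iff_false]
  rintro ⟨⟨-, -, -, -, h5⟩, h⟩
  rw [Finset.range_add_one, Finset.filter_insert, if_pos h,
    Finset.card_insert_of_notMem (by simp)] at h5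
  simp at h5

/-- The image of a trailing closer is not a trailing closer. -/
theorem involutions321_apply_lt {n k : ℕ} {H : Finset ℕ} {f : Equiv.Perm ℕ}
    (hf : f ∈ involutions321 n H k) {x : ℕ} (hx : x ∈ H) : f x < n := by
  obtain ⟨h1, h2, -, h4, -⟩ := hf
  by_contra h
  have h6 := h4 x hx
  by_cases h7 : f x ∈ H
  · have := h4 _ h7
    rw [h1] at this
    lia
  · have := h2 _ (by lia) h7
    rw [h1] at this
    lia

/-- An element of `H` and its partner enclose `n`, and a fixed point under an arc is the middle of a
321. -/
theorem involutions321_fixed_nonempty (n k : ℕ) {H : Finset ℕ} (hH : ∀ x ∈ H, n < x)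
    (hne : H.Nonempty) : {f ∈ involutions321 (n + 1) H k | f n = n} = ∅ := by
  ext f
  simp only [Set.mem_ofPred_eq, Set.mem_empty_iff_false, iff_false]
  rintro ⟨hf, h⟩
  obtain ⟨x, hx⟩ := hne
  have h6 := involutions321_apply_lt hf hx
  obtain ⟨h1, h2, h3, h4, h5⟩ := hf
  have h7 : f x ≠ n := fun h8 => by
    have := h1 x
    have := hH x hx
    rw [h8, h] at *
    lia
  have := hH x hx
  refine h3 (f x) n x (by lia) (by lia) (Or.inr hx) (by lia) this ?_ ?_
  · rw [h1, h]; exact this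
  · rw [h]; lia

/-- Otherwise the arc of `n` is nested inside the arc of `M = max H`: the positions `f M < n < f n`
carry the values `M > f n > n`. -/
theorem involutions321_opener_eq_max {n k : ℕ} {H : Finset ℕ}
    (hne : H.Nonempty) {f : Equiv.Perm ℕ} (hf : f ∈ involutions321 (n + 1) H k) (h : n < f n) :
    f n = H.max' hne := by
  have hM := H.max'_mem hne
  have h6 := involutions321_apply_lt hf hM
  obtain ⟨h1, h2, h3, h4, h5⟩ := hf
  have hnH : f n ∈ H := by
    by_contra h7
    have := h2 _ h h7
    rw [h1] at this
    lia
  by_contra h7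
  have h8 : f n < H.max' hne := lt_of_le_of_ne (H.le_max' _ hnH) h7
  have h9 : f (H.max' hne) ≠ n := fun h10 => h7 (by rw [← h10, h1])
  refine h3 (f (H.max' hne)) n (f n) (by lia) (by lia) (Or.inr hnH) (by lia) h ?_ ?_
  · rw [h1]; exact h8
  · rw [h1]; exact h

theorem involutions321_opener_empty (n k : ℕ) :
    {f ∈ involutions321 (n + 1) ∅ k | n < f n} = ∅ := by
  ext f
  simp only [Set.mem_ofPred_eq, Set.mem_empty_iff_false, iff_false]
  rintro ⟨⟨h1, h2, -⟩, h⟩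
  have := h2 _ h (by simp)
  rw [h1] at this
  lia

theorem swap_mul_apply_of_ne {g : Equiv.Perm ℕ} {n M x : ℕ} (h : g n = n) (h' : g M = M)
    (hx : x ≠ n) (hx' : x ≠ M) : (Equiv.swap n M * g) x = g x :=
  Equiv.swap_apply_of_ne_of_ne (fun e => hx (g.injective (e.trans h.symm)))
    (fun e => hx' (g.injective (e.trans h'.symm)))

theorem swap_mul_involutive {g : Equiv.Perm ℕ} {n M : ℕ} (h : g n = n) (h' : g M = M)
    (hg : ∀ x, g (g x) = x) (x : ℕ) :
    (Equiv.swap n M * g) ((Equiv.swap n M * g) x) = x := by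
  by_cases hx : x = n
  · subst hx; simp [h, h']
  by_cases hx' : x = M
  · subst hx'; simp [h, h']
  rw [swap_mul_apply_of_ne h h' hx hx', swap_mul_apply_of_ne h h', hg]
  · exact fun e => hx (g.injective (e.trans h.symm))
  · exact fun e => hx' (g.injective (e.trans h'.symm))

/-- The delicate direction: inserting the arc from `n` to `M = max H` creates no 321. No relevant
value exceeds `M`, so `n`, which carries the value `M`, can only be the first point of a pattern,
and `M` only the last; in both cases the involution reflects the other points into a 321 of `g`. -/
theorem swap_mul_mem_involutions321 {n k M : ℕ} {H : Finset ℕ} (hH : ∀ x ∈ H, n < x)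
    (hM : M ∈ H) (hMle : ∀ x ∈ H, x ≤ M) {g : Equiv.Perm ℕ}
    (hg : g ∈ involutions321 n (H.erase M) k) :
    Equiv.swap n M * g ∈ involutions321 (n + 1) H k := by
  have hlt : ∀ x ∈ H, x ≠ M → g x < n := fun x hx hxM =>
    involutions321_apply_lt hg (Finset.mem_erase.2 ⟨hxM, hx⟩)
  obtain ⟨h1, h2, h3, h4, h5⟩ := hg
  have hnM := hH M hM
  have gn : g n = n := h2 n le_rfl fun h => (hH n (Finset.mem_of_mem_erase h)).ne rfl
  have gM : g M = M := h2 M hnM.le (by simp)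
  set f := Equiv.swap n M * g with hf
  have fn : f n = M := by simp [hf, gn]
  have fM : f M = n := by simp [hf, gM]
  have fx : ∀ x, x ≠ n → x ≠ M → f x = g x := fun x => swap_mul_apply_of_ne gn gM
  have gne : ∀ x, x ≠ n → g x ≠ n := fun x hx e => hx (g.injective (e.trans gn.symm))
  have gne' : ∀ x, x ≠ M → g x ≠ M := fun x hx e => hx (g.injective (e.trans gM.symm))
  have hgH : ∀ x, (x < n + 1 ∨ x ∈ H) → x ≠ M → n < g x → g x ∈ H ∧ x < n := by
    intro x hx hxM hgx
    have hxn : x < n := by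
      rcases hx with hx | hx
      · rcases (Nat.lt_succ_iff.1 hx).eq_or_lt with rfl | hx
        · lia
        · exact hx
      · have := hlt x hx hxM
        lia
    refine ⟨?_, hxn⟩
    by_contra h
    have := h2 (g x) hgx.le (fun h' => h (Finset.mem_of_mem_erase h'))
    rw [h1] at this
    lia
  refine ⟨swap_mul_involutive gn gM h1, ?_, ?_, ?_, ?_⟩
  · intro x hx hxH
    rw [fx x (by lia) (fun h => hxH (h ▸ hM))]
    exact h2 x (by lia) (fun h => hxH (Finset.mem_of_mem_erase h))
  · intro a b c ha hb hc hab hbc h6 h7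
    have hmem : ∀ x, (x < n + 1 ∨ x ∈ H) → x ≠ n → x ≠ M → (x < n ∨ x ∈ H.erase M) := by
      intro x hx hxn hxM
      rw [Finset.mem_erase]
      rcases hx with hx | hx
      · left; lia
      · right; exact ⟨hxM, hx⟩
    have hcM : c ≤ M := by
      rcases hc with hc | hc
      · lia
      · exact hMle c hc
    have hfM : ∀ x, (x < n + 1 ∨ x ∈ H) → x < M → x ≠ n → g x ≤ M := by
      intro x hx hxM hxn
      by_contra h
      have := hgH x hx hxM.ne (by lia)
      have := hMle _ this.1
      lia
    by_cases ecM : c = M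
    · rw [ecM, fM] at h7
      by_cases ebn : b = n
      · rw [ebn, fn, fx a (by lia) (by lia)] at h6
        have := hfM a ha (by lia) (by lia)
        lia
      -- Here `g b > n` forces `g b` to be another element of `H`, so `a < b < g b` are the
      -- positions of a 321 in `g`.
      · rw [fx b ebn (by lia)] at h6 h7
        obtain ⟨hb1, hb2⟩ := hgH b hb (by lia) h7
        rw [fx a (by lia) (by lia)] at h6
        exact h3 a b (g b) (by lia) (by lia) (Or.inr (Finset.mem_erase.2 ⟨gne' b (by lia), hb1⟩))
          hab (by lia) h6 (by rw [h1]; lia)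
    · by_cases ecn : c = n
      · rw [ecn, fn, fx b (by lia) (by lia)] at h7
        have := hfM b hb (by lia) (by lia)
        lia
      · rw [fx c ecn ecM] at h7
        by_cases ebn : b = n
        · rw [ebn, fn, fx a (by lia) (by lia)] at h6
          have := hfM a ha (by lia) (by lia)
          lia
        · rw [fx b ebn (by lia)] at h6 h7
          -- If the pattern starts at `n`, then `b` and `c` are closers, and the positions `g c < g
          -- b < b` carry the values `c > b > g b`.
          by_cases ean : a = n
          · have hb' : b ∈ H := hb.resolve_left (by lia)
            have hc' : c ∈ H := hc.resolve_left (by lia)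
            have := hlt b hb' (by lia)
            refine h3 (g c) (g b) b (by lia) (by lia) (hmem b hb ebn (by lia)) h7 (by lia) ?_ ?_
            · rw [h1, h1]; exact hbc
            · rw [h1]; lia
          · rw [fx a ean (by lia)] at h6
            exact h3 a b c (hmem a ha ean (by lia)) (hmem b hb ebn (by lia))
              (hmem c hc ecn ecM) hab hbc h6 h7
  · intro x hx
    by_cases hxM : x = M
    · rw [hxM, fM]; exact hnM
    · rw [fx x (hH x hx).ne' hxM]
      exact h4 x (Finset.mem_erase.2 ⟨hxM, hx⟩)
  · rw [Finset.range_add_one, Finset.filter_insert, if_neg (by lia), ← h5]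
    congr 1
    refine Finset.filter_congr fun x hx => ?_
    have := Finset.mem_range.1 hx
    rw [fx x (by lia) (by lia)]

theorem swap_mul_mem_involutions321_erase {n k M : ℕ} {H : Finset ℕ} (hH : ∀ x ∈ H, n < x)
    (hM : M ∈ H) {f : Equiv.Perm ℕ} (hf : f ∈ involutions321 (n + 1) H k) (fn : f n = M) :
    Equiv.swap n M * f ∈ involutions321 n (H.erase M) k := by
  obtain ⟨h1, h2, h3, h4, h5⟩ := hf
  have hnM := hH M hM
  have fM : f M = n := by rw [← fn, h1]
  set g := Equiv.swap n M * f with hg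
  have gn : g n = n := by simp [hg, fn]
  have gM : g M = M := by simp [hg, fM]
  have gx : ∀ x, x ≠ n → x ≠ M → g x = f x := fun x hx hx' =>
    Equiv.swap_apply_of_ne_of_ne (fun e => hx' (f.injective (e.trans fM.symm)))
      (fun e => hx (f.injective (e.trans fn.symm)))
  have hmem : ∀ x, (x < n ∨ x ∈ H.erase M) → (x < n + 1 ∨ x ∈ H) ∧ x ≠ n ∧ x ≠ M := by
    rintro x (hx | hx)
    · exact ⟨by lia, by lia, by lia⟩
    · have := Finset.mem_erase.1 hx
      exact ⟨Or.inr this.2, (hH x this.2).ne', this.1⟩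
  refine ⟨?_, ?_, ?_, ?_, ?_⟩
  · intro x
    by_cases hx : x = n
    · rw [hx, gn, gn]
    by_cases hx' : x = M
    · rw [hx', gM, gM]
    rw [gx x hx hx', gx, h1]
    · exact fun e => hx' (f.injective (e.trans fM.symm))
    · exact fun e => hx (f.injective (e.trans fn.symm))
  · intro x hx hxH
    by_cases hx' : x = n
    · rw [hx', gn]
    by_cases hx'' : x = M
    · rw [hx'', gM]
    rw [gx x hx' hx'']
    exact h2 x (by lia) fun h => hxH (Finset.mem_erase.2 ⟨hx'', h⟩)
  · intro a b c ha hb hc hab hbc h6 h7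
    obtain ⟨ha, ha1, ha2⟩ := hmem a ha
    obtain ⟨hb, hb1, hb2⟩ := hmem b hb
    obtain ⟨hc, hc1, hc2⟩ := hmem c hc
    rw [gx a ha1 ha2, gx b hb1 hb2] at h6
    rw [gx b hb1 hb2, gx c hc1 hc2] at h7
    exact h3 a b c ha hb hc hab hbc h6 h7
  · intro x hx
    obtain ⟨-, hx1, hx2⟩ := hmem x (Or.inr hx)
    rw [gx x hx1 hx2]
    exact h4 x (Finset.mem_of_mem_erase hx)
  · rw [Finset.range_add_one, Finset.filter_insert, if_neg (by lia)] at h5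
    rw [← h5]
    congr 1
    refine Finset.filter_congr fun x hx => ?_
    have := Finset.mem_range.1 hx
    rw [gx x (by lia) (by lia)]

theorem involutions321_opener {n k : ℕ} {H : Finset ℕ} (hH : ∀ x ∈ H, n < x)
    (hne : H.Nonempty) : {f ∈ involutions321 (n + 1) H k | n < f n} =
      (fun g => Equiv.swap n (H.max' hne) * g) '' involutions321 n (H.erase (H.max' hne)) k := by
  have hM := H.max'_mem hne
  ext f
  constructor
  · rintro ⟨hf, h⟩
    have fn := involutions321_opener_eq_max hne hf h
    refine ⟨_, swap_mul_mem_involutions321_erase hH hM hf fn, ?_⟩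
    simp [← mul_assoc]
  · rintro ⟨g, hg, rfl⟩
    refine ⟨swap_mul_mem_involutions321 hH hM (fun x hx => H.le_max' x hx) hg, ?_⟩
    have gn : g n = n := hg.2.1 n le_rfl fun h => (hH n (Finset.mem_of_mem_erase h)).ne rfl
    simpa [gn] using hH _ hM

/-- The count depends on `H` and `k` only through `H.card + k`: a closer raises this sum by one,
while a fixed point (possible if `H` is empty) or an opener (possible if it is not) lowers it by
one. -/
theorem encard_involutions321 (n : ℕ) (H : Finset ℕ) (k : ℕ) (hH : ∀ x ∈ H, n ≤ x) :
    (involutions321 n H k).encard = ballot n (H.card + k) := by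
  induction n generalizing H k with
  | zero => exact involutions321_zero H k
  | succ n ih =>
    have hsplit : involutions321 (n + 1) H k =
        ({f ∈ involutions321 (n + 1) H k | f n < n} ∪ {f ∈ involutions321 (n + 1) H k | f n = n}) ∪
          {f ∈ involutions321 (n + 1) H k | n < f n} := by
      ext f
      have := lt_trichotomy (f n) n
      simp only [Set.mem_union, Set.mem_ofPred_eq]
      tauto
    have hlt : ∀ x ∈ H, n < x := fun x hx => hH x hx
    have hnH : n ∉ H := fun h => (hlt n h).ne rfl
    rw [hsplit, Set.encard_union_eq, Set.encard_union_eq, involutions321_closer,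
      ih _ _ (by simpa using fun x hx => (hlt x hx).le), Finset.card_insert_of_notMem hnH]
    · rcases H.eq_empty_or_nonempty with rfl | hne
      · rw [involutions321_opener_empty]
        cases k with
        | zero => simp [involutions321_fixed_zero, ballot]
        | succ k =>
          rw [involutions321_fixed_empty, ih _ _ (by simp)]
          simp only [Finset.card_empty, Set.encard_empty, add_zero, zero_add]
          rw [show 1 + (k + 1) = k + 2 by ring, ballot]
          push_cast
          ring
      · rw [involutions321_fixed_nonempty n k hlt hne, involutions321_opener hlt hne,
          (mul_right_injective _).injOn.encard_image,
          ih _ _ (fun x hx => (hlt x (Finset.mem_of_mem_erase hx)).le),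
          Finset.card_erase_of_mem (H.max'_mem hne)]
        have hc : 0 < H.card := hne.card_pos
        obtain ⟨h, hh⟩ : ∃ h, H.card = h + 1 := ⟨H.card - 1, by lia⟩
        rw [hh, show h + 1 + k = (h + k) + 1 by ring, ballot,
          show h + 1 + 1 + k = h + k + 2 by ring, Nat.add_sub_cancel]
        simp only [Set.encard_empty, add_zero]
        push_cast
        ring
    · rw [Set.disjoint_left]
      rintro f ⟨-, h⟩ ⟨-, h'⟩
      lia
    · rw [Set.disjoint_left]
      rintro f (⟨-, h⟩ | ⟨-, h⟩) ⟨-, h'⟩ <;> lia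

/-! ### Counting the involutions that avoid `132` -/

/-- The involutions of `{0, …, n - 1}` (extended by the identity) that avoid `132` and have `k`
fixed points. -/
def involutions132 (n k : ℕ) : Set (Equiv.Perm ℕ) :=
  {f | (∀ x, f (f x) = x) ∧ (∀ x, n ≤ x → f x = x) ∧
    (∀ a b c, a < b → b < c → c < n → f a < f c → f c < f b → False) ∧
    ((Finset.range n).filter fun x => f x = x).card = k}

theorem involutions132_apply_lt {n k : ℕ} {f : Equiv.Perm ℕ} (hf : f ∈ involutions132 n k) {p : ℕ}
    (hp : p < n) : f p < n := by
  by_contra h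
  have := hf.2.1 (f p) (by lia)
  rw [hf.1] at this
  lia

theorem involutions132_zero (k : ℕ) : (involutions132 0 k).encard = ballot 0 k := by
  rcases Nat.eq_zero_or_pos k with rfl | hk
  · have : involutions132 0 0 = {1} := by
      ext f
      simp only [involutions132, Set.mem_ofPred_eq, Set.mem_singleton_iff]
      constructor
      · rintro ⟨-, h, -⟩
        ext x
        simpa using h x (Nat.zero_le _)
      · rintro rfl
        simp
    simp [this, ballot]
  · have : involutions132 0 k = ∅ := by
      ext f
      simp [involutions132]
      intros; omega
    simp [this, ballot, hk.ne']

theorem involutions132_fixed (n k : ℕ) :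
    {f ∈ involutions132 (n + 1) (k + 1) | f n = n} = involutions132 n k := by
  ext f
  constructor
  · rintro ⟨⟨h1, h2, h3, h5⟩, h⟩
    refine ⟨h1, fun x hx => ?_, ?_, ?_⟩
    · rcases hx.eq_or_lt with rfl | hx
      · exact h
      · exact h2 x hx
    · intro a b c hab hbc hc
      exact h3 a b c hab hbc (by lia)
    · rw [Finset.range_add_one, Finset.filter_insert, if_pos h,
        Finset.card_insert_of_notMem (by simp)] at h5
      lia
  · intro hf
    have hlt := fun p => involutions132_apply_lt hf (p := p)
    obtain ⟨h1, h2, h3, h5⟩ := hf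
    have h := h2 n le_rfl
    refine ⟨⟨h1, fun x hx => h2 x (by lia), ?_, ?_⟩, h⟩
    · intro a b c hab hbc hc h6 h7
      by_cases hcn : c = n
      · have := hlt b (by lia)
        rw [hcn, h] at h7
        lia
      · exact h3 a b c hab hbc (by lia) h6 h7
    · rw [Finset.range_add_one, Finset.filter_insert, if_pos h,
        Finset.card_insert_of_notMem (by simp), h5]

theorem involutions132_fixed_zero (n : ℕ) : {f ∈ involutions132 (n + 1) 0 | f n = n} = ∅ := by
  ext f
  simp only [involutions132, Set.mem_ofPred_eq, Set.mem_empty_iff_false, iff_false]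
  rintro ⟨⟨-, -, -, h5⟩, h⟩
  rw [Finset.range_add_one, Finset.filter_insert, if_pos h,
    Finset.card_insert_of_notMem (by simp)] at h5
  simp at h5

/-- The cycle `x ↦ j ↦ j + 1 ↦ ⋯ ↦ x` (the identity if `x < j`). -/
def cycleIcc (j x : ℕ) : Equiv.Perm ℕ where
  toFun p := if p = x ∧ j ≤ x then j else if j ≤ p ∧ p < x then p + 1 else p
  invFun p := if p = j ∧ j ≤ x then x else if j < p ∧ p ≤ x then p - 1 else p
  left_inv p := by dsimp only; split_ifs <;> lia
  right_inv p := by dsimp only; split_ifs <;> lia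

theorem cycleIcc_apply (j x p : ℕ) :
    cycleIcc j x p = if p = x ∧ j ≤ x then j else if j ≤ p ∧ p < x then p + 1 else p := rfl

/-- `π` arises from `σ` by replacing the fixed point `n - 1 - j` by the transposition `(j n)`,
all other points being relabelled increasingly; `σ` exchanges the first `j` points with the last
`j` points. -/
structure Opens (n j : ℕ) (π σ : Equiv.Perm ℕ) : Prop where
  two_mul_lt : 2 * j < n
  apply_left : π j = n
  apply_right : π n = j
  apply_fixed : σ (n - 1 - j) = n - 1 - j
  apply_cycle : ∀ p < n, p ≠ n - 1 - j →
    π (cycleIcc j (n - 1 - j) p) = cycleIcc j (n - 1 - j) (σ p)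
  lt_iff : ∀ p < n, p ≠ n - 1 - j → (p < j ↔ n - 1 - j < σ p)

namespace Opens

variable {n j : ℕ} {π σ : Equiv.Perm ℕ}

theorem ne_fixed (h : Opens n j π σ) {p : ℕ} (hp : p ≠ n - 1 - j) : σ p ≠ n - 1 - j :=
  fun e => hp (σ.injective (e.trans h.apply_fixed.symm))

theorem exists_preimage (h : Opens n j π σ) {a : ℕ} (ha : a < n) (haj : a ≠ j) :
    ∃ p < n, p ≠ n - 1 - j ∧ cycleIcc j (n - 1 - j) p = a := by
  have := h.two_mul_lt
  refine ⟨(cycleIcc j (n - 1 - j)).symm a, ?_, ?_, by simp⟩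
  · change (if _ then _ else _) < _
    split_ifs <;> lia
  · change (if _ then _ else _) ≠ _
    split_ifs <;> lia

/-- The relabelling matches the fixed points of `π` with those of `σ` other than `n - 1 - j`; the
points `j` and `n` of `π` are exchanged. -/
theorem card_fixed (h : Opens n j π σ) :
    ((Finset.range n).filter fun x => σ x = x).card =
      ((Finset.range (n + 1)).filter fun x => π x = x).card + 1 := by
  have hj := h.two_mul_lt
  have key : ((Finset.range (n + 1)).filter fun x => π x = x) =
      (((Finset.range n).filter fun x => σ x = x).erase (n - 1 - j)).image
        (cycleIcc j (n - 1 - j)) := by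
    ext a
    simp only [Finset.mem_filter, Finset.mem_range, Finset.mem_image, Finset.mem_erase]
    constructor
    · rintro ⟨ha, ha'⟩
      have haj : a ≠ j := fun e => by
        have := h.apply_left; rw [e] at ha'; lia
      have han : a ≠ n := fun e => by
        have := h.apply_right; rw [e] at ha'; lia
      obtain ⟨p, hp, hpx, rfl⟩ := h.exists_preimage (by lia) haj
      refine ⟨p, ⟨hpx, hp, ?_⟩, rfl⟩
      rw [h.apply_cycle p hp hpx] at ha'
      exact (cycleIcc _ _).injective ha'
    · rintro ⟨p, ⟨hpx, hp, hfix⟩, rfl⟩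
      refine ⟨?_, ?_⟩
      · rw [cycleIcc_apply]; split_ifs <;> lia
      · rw [h.apply_cycle p hp hpx, hfix]
  rw [key, Finset.card_image_of_injective _ (cycleIcc _ _).injective, Finset.card_erase_add_one]
  simp only [Finset.mem_filter, Finset.mem_range]
  exact ⟨by lia, h.apply_fixed⟩

/-- The cycle is increasing away from the one point where it wraps around, so it preserves patterns
that miss this point. -/
theorem cycleIcc_lt_iff {j x p q : ℕ} (hp : p ≠ x) (hq : q ≠ x) :
    cycleIcc j x p < cycleIcc j x q ↔ p < q := by
  rw [cycleIcc_apply, cycleIcc_apply]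
  split_ifs <;> lia

/-- The block structure (the first `j` points exchanged with the last `j`) rules out every 132 of
`π` through `j` or `n`. Any other 132 pulls back along the increasing relabelling to one of `σ`. -/
theorem avoids_left (h : Opens n j π σ) (hσ : ∀ x, σ (σ x) = x) (hlt : ∀ p < n, σ p < n)
    (hav : ∀ a b c, a < b → b < c → c < n → σ a < σ c → σ c < σ b → False)
    {a b c : ℕ} (hab : a < b) (hbc : b < c) (hc : c < n + 1) (h1 : π a < π c) (h2 : π c < π b) :
    False := by
  have hj := h.two_mul_lt
  have hπ : ∀ p < n, p ≠ j → (p < j ↔ n - 1 - j < π p) ∧ (π p < j ↔ n - 1 - j < p) ∧ π p < n := by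
    intro a ha haj
    obtain ⟨p, hp, hpx, rfl⟩ := h.exists_preimage ha haj
    rw [h.apply_cycle p hp hpx]
    have e1 := h.lt_iff p hp hpx
    have e2 := h.lt_iff (σ p) (hlt p hp) (h.ne_fixed hpx)
    have e3 := h.ne_fixed hpx
    have e4 := hlt p hp
    rw [hσ] at e2
    rw [cycleIcc_apply, cycleIcc_apply]
    split_ifs <;> lia
  have hl := h.apply_left
  have hr := h.apply_right
  by_cases ecn : c = n
  · rw [ecn, hr] at h1 h2
    by_cases eaj : a = j
    · rw [eaj, hl] at h1; lia
    have ea := hπ a (by lia) eaj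
    by_cases ebj : b = j
    · lia
    have eb := hπ b (by lia) ebj
    lia
  by_cases ecj : c = j
  · rw [ecj, hl] at h2
    have eb := hπ b (by lia) (by lia)
    lia
  by_cases eaj : a = j
  · rw [eaj, hl] at h1
    have ec := hπ c (by lia) (by lia)
    lia
  by_cases ebj : b = j
  · have ea := hπ a (by lia) eaj
    have ec := hπ c (by lia) ecj
    lia
  obtain ⟨p, hp, hpx, rfl⟩ := h.exists_preimage (a := a) (by lia) eaj
  obtain ⟨q, hq, hqx, rfl⟩ := h.exists_preimage (a := b) (by lia) ebj
  obtain ⟨r, hr, hrx, rfl⟩ := h.exists_preimage (a := c) (by lia) ecj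
  rw [h.apply_cycle _ hp hpx, h.apply_cycle _ hr hrx,
    cycleIcc_lt_iff (h.ne_fixed hpx) (h.ne_fixed hrx)] at h1
  rw [h.apply_cycle _ hq hqx, h.apply_cycle _ hr hrx,
    cycleIcc_lt_iff (h.ne_fixed hrx) (h.ne_fixed hqx)] at h2
  exact hav p q r ((cycleIcc_lt_iff hpx hqx).1 hab) ((cycleIcc_lt_iff hqx hrx).1 hbc) hr h1 h2

/-- As in `avoids_left`, with the inserted fixed point `n - 1 - j` as the only exceptional position.
-/
theorem avoids_right (h : Opens n j π σ) (hσ : ∀ x, σ (σ x) = x) (hlt : ∀ p < n, σ p < n)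
    (hav : ∀ a b c, a < b → b < c → c < n + 1 → π a < π c → π c < π b → False)
    {a b c : ℕ} (hab : a < b) (hbc : b < c) (hc : c < n) (h1 : σ a < σ c) (h2 : σ c < σ b) :
    False := by
  have hj := h.two_mul_lt
  have hs : ∀ p < n, p ≠ n - 1 - j → (p < j ↔ n - 1 - j < σ p) ∧ (σ p < j ↔ n - 1 - j < p) ∧
      σ p ≠ n - 1 - j := by
    intro p hp hpx
    have e2 := h.lt_iff (σ p) (hlt p hp) (h.ne_fixed hpx)
    rw [hσ] at e2
    exact ⟨h.lt_iff p hp hpx, e2, h.ne_fixed hpx⟩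
  have hx := h.apply_fixed
  by_cases eax : a = n - 1 - j
  · have eb := hs b (by lia) (by lia)
    have ec := hs c (by lia) (by lia)
    rw [eax, hx] at h1
    lia
  have ea := hs a (by lia) eax
  by_cases ebx : b = n - 1 - j
  · have ec := hs c (by lia) (by lia)
    rw [ebx, hx] at h2
    lia
  have eb := hs b (by lia) ebx
  by_cases ecx : c = n - 1 - j
  · rw [ecx, hx] at h1 h2
    lia
  have ec := hs c (by lia) ecx
  refine hav (cycleIcc j (n - 1 - j) a) (cycleIcc j (n - 1 - j) b) (cycleIcc j (n - 1 - j) c)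
    ((cycleIcc_lt_iff eax ebx).2 hab) ((cycleIcc_lt_iff ebx ecx).2 hbc) ?_ ?_ ?_
  · rw [cycleIcc_apply]; split_ifs <;> lia
  · rwa [h.apply_cycle _ (by lia) eax, h.apply_cycle _ hc ecx, cycleIcc_lt_iff ea.2.2 ec.2.2]
  · rwa [h.apply_cycle _ (by lia) ebx, h.apply_cycle _ hc ecx, cycleIcc_lt_iff ec.2.2 eb.2.2]

end Opens

/-- A finite lower set of naturals is an initial segment. -/
theorem mem_iff_lt_card_of_isLowerSet {s : Finset ℕ} (hs : IsLowerSet (s : Set ℕ)) (a : ℕ) :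
    a ∈ s ↔ a < s.card := by
  have hsub : s ⊆ Finset.range s.card := fun b hb => by
    have : Finset.range (b + 1) ⊆ s := fun c hc =>
      hs (Nat.lt_succ_iff.1 (Finset.mem_range.1 hc)) hb
    have := Finset.card_le_card this
    rw [Finset.card_range] at this
    exact Finset.mem_range.2 this
  rw [Finset.eq_of_subset_of_card_le hsub (by simp), Finset.card_range, Finset.mem_range]

/-- Put `j = π n`. The points after `j` are mapped onto an initial segment of size `n - j`: if `b <
π r` with `j < r` and `π b < j`, then the positions `π b < j < r` carry the values `b < π r < n` in
the order of 132. Counting turns this lower set into an inequality. -/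
theorem involutions132_lt_iff {n k : ℕ} {π : Equiv.Perm ℕ} (hπ : π ∈ involutions132 (n + 1) k)
    {p : ℕ} (hp : p ≤ n) : π n < p ↔ π p < n - π n := by
  have hlt := fun p => involutions132_apply_lt hπ (p := p)
  obtain ⟨h1, h2, h3, -⟩ := hπ
  have hl : π (π n) = n := h1 n
  have hlow : IsLowerSet (((Finset.Ioc (π n) n).image π : Finset ℕ) : Set ℕ) := by
    intro a b hba ha
    simp only [Finset.coe_image, Finset.coe_Ioc, Set.mem_image, Set.mem_Ioc] at ha ⊢
    obtain ⟨r, ⟨hr, hrn⟩, rfl⟩ := ha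
    have hrlt := hlt r (by lia)
    have hrne : π r ≠ n := fun e => by
      have := π.injective (e.trans hl.symm); lia
    refine ⟨π b, ⟨?_, ?_⟩, h1 b⟩
    · by_contra h
      by_cases e : π b = π n
      · have := π.injective e; lia
      · have hne : b ≠ π r := fun e' => by
          have := h1 r; rw [e'] at h; lia
        refine h3 (π b) (π n) r (by lia) hr (by lia) ?_ ?_
        · rw [h1]; lia
        · rw [hl]; lia
    · have := hlt b (by lia); lia
  have key := mem_iff_lt_card_of_isLowerSet hlow (π p)
  rw [Finset.card_image_of_injective _ π.injective, Nat.card_Ioc] at key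
  rw [← key]
  simp only [Finset.mem_image, Finset.mem_Ioc]
  constructor
  · exact fun h => ⟨p, ⟨h, hp⟩, rfl⟩
  · rintro ⟨r, hr, e⟩
    rw [← π.injective e]; exact hr.1

/-- The inverse of the replacement described by `Opens`. -/
def closeLast (n : ℕ) (π : Equiv.Perm ℕ) : Equiv.Perm ℕ :=
  (cycleIcc (π n) (n - 1 - π n))⁻¹ * (Equiv.swap (π n) n * π) * cycleIcc (π n) (n - 1 - π n)

theorem opens_closeLast {n k : ℕ} {π : Equiv.Perm ℕ} (hπ : π ∈ involutions132 (n + 1) k)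
    (hj : π n < n) : Opens n (π n) π (closeLast n π) := by
  have hiff := fun p hp => involutions132_lt_iff hπ (p := p) hp
  obtain ⟨h1, h2, h3, -⟩ := hπ
  have hl : π (π n) = n := h1 n
  unfold closeLast
  generalize hjn : π n = j at *
  have hj2 : 2 * j < n := by
    -- At `p = n` the block criterion reads `j < n - j`.
    have := (hiff n le_rfl).1 (by lia); lia
  have hcyc : ∀ p < n, p ≠ n - 1 - j → π (cycleIcc j (n - 1 - j) p) = cycleIcc j (n - 1 - j)
      (((cycleIcc j (n - 1 - j))⁻¹ * (Equiv.swap j n * π) * cycleIcc j (n - 1 - j)) p) := by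
    intro p hp hpx
    simp only [Equiv.Perm.mul_apply, Equiv.Perm.inv_def, Equiv.apply_symm_apply]
    rw [Equiv.swap_apply_of_ne_of_ne]
    · intro e
      have := π.injective (e.trans hjn.symm)
      rw [cycleIcc_apply] at this
      split_ifs at this <;> lia
    · intro e
      have := π.injective (e.trans hl.symm)
      rw [cycleIcc_apply] at this
      split_ifs at this <;> lia
  have hfix : ((cycleIcc j (n - 1 - j))⁻¹ * (Equiv.swap j n * π) * cycleIcc j (n - 1 - j))
      (n - 1 - j) = n - 1 - j := by
    have e : cycleIcc j (n - 1 - j) (n - 1 - j) = j := by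
      rw [cycleIcc_apply]; split_ifs <;> lia
    simp only [Equiv.Perm.mul_apply, e, hl, Equiv.swap_apply_right]
    rw [Equiv.Perm.inv_eq_iff_eq, e]
  refine ⟨hj2, hl, hjn, hfix, hcyc, ?_⟩
  intro p hp hpx
  have e1 := hcyc p hp hpx
  have e0 : ((cycleIcc j (n - 1 - j))⁻¹ * (Equiv.swap j n * π) * cycleIcc j (n - 1 - j)) p ≠
      n - 1 - j := fun e => hpx (Equiv.injective _ (e.trans hfix.symm))
  generalize ((cycleIcc j (n - 1 - j))⁻¹ * (Equiv.swap j n * π) * cycleIcc j (n - 1 - j)) p = y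
    at *
  have e2 := hiff (cycleIcc j (n - 1 - j) p) (by rw [cycleIcc_apply]; split_ifs <;> lia)
  rw [e1, cycleIcc_apply, cycleIcc_apply] at e2
  split_ifs at e2 <;> lia

theorem closeLast_mem {n k : ℕ} {π : Equiv.Perm ℕ} (hπ : π ∈ involutions132 (n + 1) k)
    (hj : π n < n) : closeLast n π ∈ involutions132 n (k + 1) := by
  have ho := opens_closeLast hπ hj
  obtain ⟨h1, h2, h3, h4⟩ := hπ
  have hl : π (π n) = n := h1 n
  have hinv : ∀ x, (Equiv.swap (π n) n * π) ((Equiv.swap (π n) n * π) x) = x := by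
    intro x
    by_cases hx : x = n
    · simp [hx]
    by_cases hx' : x = π n
    · simp [hx', hl]
    have e : (Equiv.swap (π n) n * π) x = π x :=
      Equiv.swap_apply_of_ne_of_ne (fun e => hx (π.injective e))
        (fun e => hx' (π.injective (e.trans hl.symm)))
    rw [e, Equiv.Perm.mul_apply, h1, Equiv.swap_apply_of_ne_of_ne hx' hx]
  have hσ : ∀ x, closeLast n π (closeLast n π x) = x := by
    intro x
    simp only [closeLast, Equiv.Perm.mul_apply, Equiv.Perm.inv_def,
      Equiv.apply_symm_apply] at hinv ⊢
    rw [hinv, Equiv.symm_apply_apply]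
  have hout : ∀ x, n ≤ x → closeLast n π x = x := by
    intro x hx
    have e : cycleIcc (π n) (n - 1 - π n) x = x := by
      rw [cycleIcc_apply]; split_ifs <;> lia
    simp only [closeLast, Equiv.Perm.mul_apply, e]
    rw [Equiv.Perm.inv_eq_iff_eq, e]
    rcases hx.eq_or_lt with rfl | hx
    · simp
    · rw [h2 x hx, Equiv.swap_apply_of_ne_of_ne (by lia) (by lia)]
  have hlt : ∀ p < n, closeLast n π p < n := by
    intro p hp
    by_contra h
    have := hout _ (not_lt.1 h)
    rw [hσ] at this
    lia
  exact ⟨hσ, hout, fun a b c hab hbc hc => ho.avoids_right hσ hlt h3 hab hbc hc,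
    by rw [ho.card_fixed, h4]⟩

/-- The point `n - 1 - π n` is the last fixed point of `closeLast n π`. -/
theorem closeLast_apply_ne {n k : ℕ} {π : Equiv.Perm ℕ} (hπ : π ∈ involutions132 (n + 1) k)
    (hj : π n < n) {y : ℕ} (hy : n - 1 - π n < y) (hyn : y < n) : closeLast n π y ≠ y := by
  have ho := opens_closeLast hπ hj
  have := ho.lt_iff y hyn hy.ne'
  have := ho.two_mul_lt
  lia

/-- The image remembers `π n` through its last fixed point `n - 1 - π n`; once `π n` is known,
`closeLast` is composition with known permutations. -/
theorem injOn_closeLast (n k : ℕ) :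
    Set.InjOn (closeLast n) {π ∈ involutions132 (n + 1) k | π n < n} := by
  rintro π ⟨hπ, hj⟩ π' ⟨hπ', hj'⟩ e
  have f := (opens_closeLast hπ hj).apply_fixed
  have f' := (opens_closeLast hπ' hj').apply_fixed
  have e1 : π n = π' n := by
    rcases lt_trichotomy (π n) (π' n) with h | h | h
    · exact absurd (e ▸ f) (closeLast_apply_ne hπ' hj' (by lia) (by lia))
    · exact h
    · exact absurd (e ▸ f') (closeLast_apply_ne hπ hj (by lia) (by lia))
  simpa [closeLast, e1] using e

/-- The last fixed point `x` imposes the block structure required by `Opens` with `j = n - 1 - x`: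
the points after `x` are exchanged with the first `n - 1 - x` points, since their images form a
lower set. -/
theorem involutions132_last_fixed {n k x : ℕ} {σ : Equiv.Perm ℕ} (hσ : σ ∈ involutions132 n k)
    (hxn : x < n) (hx : σ x = x) (hlast : ∀ y, x < y → y < n → σ y ≠ y) {p : ℕ} (hp : p < n) :
    p < n - 1 - x ↔ x < σ p := by
  have hlt := fun p => involutions132_apply_lt hσ (p := p)
  obtain ⟨h1, h2, h3, -⟩ := hσ
  have hxne : ∀ p, p ≠ x → σ p ≠ x := fun p hp e => hp (σ.injective (e.trans hx.symm))
  -- An arc lying entirely to the right of `x` would form a 132 together with `x`.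
  have hlow : ∀ y, x < y → y < n → σ y < x := by
    intro y hy hyn
    by_contra h
    have e1 := hlast y hy hyn
    have e2 := hxne y hy.ne'
    have e3 := hlt y hyn
    rcases lt_or_gt_of_ne e1 with h4 | h4
    · refine h3 x (σ y) y (by lia) h4 hyn ?_ ?_
      · rw [hx]; lia
      · rw [h1]; exact h4
    · refine h3 x y (σ y) (by lia) h4 e3 ?_ ?_
      · rw [hx, h1]; exact hy
      · rw [h1]; exact h4
  have hset : IsLowerSet (((Finset.Ioo x n).image σ : Finset ℕ) : Set ℕ) := by
    intro a b hba ha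
    simp only [Finset.coe_image, Finset.coe_Ioo, Set.mem_image, Set.mem_Ioo] at ha ⊢
    obtain ⟨r, ⟨hr, hrn⟩, rfl⟩ := ha
    have hrx := hlow r hr hrn
    refine ⟨σ b, ⟨?_, hlt b (by lia)⟩, h1 b⟩
    by_contra h
    have e1 := hxne b (by lia)
    have e2 : b ≠ σ r := fun e => by rw [e, h1] at h; lia
    refine h3 b (σ r) x (by lia) hrx hxn ?_ ?_
    · rw [hx]; lia
    · rw [hx, h1]; exact hr
  have key := mem_iff_lt_card_of_isLowerSet hset p
  rw [Finset.card_image_of_injective _ σ.injective, Nat.card_Ioo] at key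
  rw [show n - 1 - x = n - x - 1 by lia, ← key]
  simp only [Finset.mem_image, Finset.mem_Ioo]
  constructor
  · rintro ⟨r, hr, rfl⟩
    rw [h1]; exact hr.1
  · exact fun h => ⟨σ p, ⟨h, hlt p hp⟩, h1 p⟩

/-- The fixed point to be opened must be the last one; `π` is obtained by moving it to position `j`
and then joining it to the new point `n`. -/
theorem exists_closeLast_eq {n k : ℕ} {σ : Equiv.Perm ℕ} (hσ : σ ∈ involutions132 n (k + 1)) :
    ∃ π ∈ involutions132 (n + 1) k, π n < n ∧ closeLast n π = σ := by
  obtain ⟨x, hxn, hx, hlast⟩ : ∃ x < n, σ x = x ∧ ∀ y, x < y → y < n → σ y ≠ y := by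
    have hne : ((Finset.range n).filter fun x => σ x = x).Nonempty := by
      rw [← Finset.card_pos, hσ.2.2.2]; lia
    have hm := Finset.max'_mem _ hne
    simp only [Finset.mem_filter, Finset.mem_range] at hm
    refine ⟨_, hm.1, hm.2, fun y hy hyn e => ?_⟩
    have := Finset.le_max' ((Finset.range n).filter fun x => σ x = x) y
      (Finset.mem_filter.2 ⟨Finset.mem_range.2 hyn, e⟩)
    lia
  have hiff := fun p hp => involutions132_last_fixed hσ hxn hx hlast (p := p) hp
  have hlt := fun p => involutions132_apply_lt hσ (p := p)
  obtain ⟨h1, h2, h3, h4⟩ := hσ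
  obtain ⟨j, hj⟩ : ∃ j, j = n - 1 - x := ⟨_, rfl⟩
  have hjx : j ≤ x := by
    have := hiff x hxn
    lia
  obtain rfl : x = n - 1 - j := by lia
  set κ := cycleIcc j (n - 1 - j) with hκ
  have κx : κ (n - 1 - j) = j := by
    rw [hκ, cycleIcc_apply]; split_ifs <;> lia
  have κout : ∀ p, n ≤ p → κ p = p := fun p hp => by
    rw [hκ, cycleIcc_apply]; split_ifs <;> lia
  have τj : (κ * σ * κ⁻¹) j = j := by
    have : κ⁻¹ j = n - 1 - j := by rw [Equiv.Perm.inv_eq_iff_eq, κx]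
    simp only [Equiv.Perm.mul_apply, this, hx, κx]
  have τout : ∀ p, n ≤ p → (κ * σ * κ⁻¹) p = p := fun p hp => by
    have : κ⁻¹ p = p := by rw [Equiv.Perm.inv_eq_iff_eq, κout p hp]
    simp only [Equiv.Perm.mul_apply, this, h2 p hp, κout p hp]
  have τinv : ∀ p, (κ * σ * κ⁻¹) ((κ * σ * κ⁻¹) p) = p := fun p => by
    simp only [Equiv.Perm.mul_apply, Equiv.Perm.inv_def, Equiv.symm_apply_apply, h1,
      Equiv.apply_symm_apply]
  have τn := τout n le_rfl
  have πn : (Equiv.swap j n * (κ * σ * κ⁻¹)) n = j := by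
    rw [Equiv.Perm.mul_apply, τn, Equiv.swap_apply_right]
  have πinv := swap_mul_involutive τj τn τinv
  have ho : Opens n j (Equiv.swap j n * (κ * σ * κ⁻¹)) σ := by
    refine ⟨by lia, ?_, πn, hx, ?_, ?_⟩
    · rw [Equiv.Perm.mul_apply, τj, Equiv.swap_apply_left]
    · intro p hp hpx
      rw [swap_mul_apply_of_ne τj τn]
      · simp [κ]
      · rw [cycleIcc_apply]; split_ifs <;> lia
      · rw [cycleIcc_apply]; split_ifs <;> lia
    · intro p hp hpx
      rw [← hiff p hp]
      lia
  refine ⟨Equiv.swap j n * (κ * σ * κ⁻¹), ⟨πinv, ?_, fun a b c hab hbc hc =>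
    ho.avoids_left h1 hlt h3 hab hbc hc, ?_⟩, by rw [πn]; lia, ?_⟩
  · intro p hp
    rw [swap_mul_apply_of_ne τj τn (by lia) (by lia)]
    exact τout p (by lia)
  · have := ho.card_fixed
    lia
  · rw [closeLast, πn, ← hκ, ← mul_assoc (Equiv.swap j n), Equiv.swap_mul_self]
    group

theorem encard_involutions132_opens (n k : ℕ) :
    {π ∈ involutions132 (n + 1) k | π n < n}.encard = (involutions132 n (k + 1)).encard := by
  rw [← (injOn_closeLast n k).encard_image]
  congr 1
  ext σ
  constructor
  · rintro ⟨π, ⟨hπ, hj⟩, rfl⟩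
    exact closeLast_mem hπ hj
  · intro hσ
    obtain ⟨π, hπ, hj, e⟩ := exists_closeLast_eq hσ
    exact ⟨π, ⟨hπ, hj⟩, e⟩

theorem encard_involutions132 (n k : ℕ) : (involutions132 n k).encard = ballot n k := by
  induction n generalizing k with
  | zero => exact involutions132_zero k
  | succ n ih =>
    have hsplit : involutions132 (n + 1) k =
        {f ∈ involutions132 (n + 1) k | f n = n} ∪ {f ∈ involutions132 (n + 1) k | f n < n} := by
      ext f
      simp only [Set.mem_union, Set.mem_ofPred_eq]
      constructor
      · intro hf
        have := involutions132_apply_lt hf (Nat.lt_succ_self n)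
        rcases (Nat.lt_succ_iff.1 this).eq_or_lt with h | h
        · exact Or.inl ⟨hf, h⟩
        · exact Or.inr ⟨hf, h⟩
      · rintro (h | h) <;> exact h.1
    rw [hsplit, Set.encard_union_eq, encard_involutions132_opens, ih]
    · cases k with
      | zero => simp [involutions132_fixed_zero, ballot]
      | succ k =>
        rw [involutions132_fixed, ih, ballot]
        push_cast
        ring
    · rw [Set.disjoint_left]
      rintro f ⟨-, h⟩ ⟨-, h'⟩
      lia

/-! ### The number of pattern-avoiding involutions with a given number of fixed points -/

theorem contains_iff {n : ℕ} (π : Equiv.Perm (Fin n)) (σ : Equiv.Perm (Fin 3)) :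
    Contains π σ ↔ ∃ a b c : Fin n, a < b ∧ b < c ∧ (π a < π b ↔ σ 0 < σ 1) ∧
      (π a < π c ↔ σ 0 < σ 2) ∧ (π b < π c ↔ σ 1 < σ 2) := by
  constructor
  · rintro ⟨i, hi, h⟩
    exact ⟨i 0, i 1, i 2, hi (by decide), hi (by decide), h 0 1 (by decide), h 0 2 (by decide),
      h 1 2 (by decide)⟩
  · rintro ⟨a, b, c, hab, hbc, h1, h2, h3⟩
    refine ⟨![a, b, c], ?_, ?_⟩
    · rw [Fin.strictMono_iff_lt_succ]
      intro i
      fin_cases i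
      · exact hab
      · exact hbc
    · intro j k hjk
      fin_cases j <;> fin_cases k <;> first | exact absurd hjk (by decide) | assumption

theorem contains_pattern321 {n : ℕ} (π : Equiv.Perm (Fin n)) :
    Contains π pattern321 ↔ ∃ a b c : Fin n, a < b ∧ b < c ∧ π b < π a ∧ π c < π b := by
  have e1 : ¬ pattern321 0 < pattern321 1 := by decide
  have e2 : ¬ pattern321 0 < pattern321 2 := by decide
  have e3 : ¬ pattern321 1 < pattern321 2 := by decide
  simp only [contains_iff, e1, e2, e3, iff_false, not_lt]
  constructor
  · rintro ⟨a, b, c, hab, hbc, h1, h2, h3⟩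
    exact ⟨a, b, c, hab, hbc, lt_of_le_of_ne h1 (π.injective.ne hab.ne'),
      lt_of_le_of_ne h3 (π.injective.ne hbc.ne')⟩
  · rintro ⟨a, b, c, hab, hbc, h1, h2⟩
    exact ⟨a, b, c, hab, hbc, h1.le, (h2.trans h1).le, h2.le⟩

theorem contains_pattern132 {n : ℕ} (π : Equiv.Perm (Fin n)) :
    Contains π pattern132 ↔ ∃ a b c : Fin n, a < b ∧ b < c ∧ π a < π c ∧ π c < π b := by
  have e1 : pattern132 0 < pattern132 1 := by decide
  have e2 : pattern132 0 < pattern132 2 := by decide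
  have e3 : ¬ pattern132 1 < pattern132 2 := by decide
  simp only [contains_iff, e1, e2, e3, iff_false, iff_true, not_lt]
  constructor
  · rintro ⟨a, b, c, hab, hbc, h1, h2, h3⟩
    exact ⟨a, b, c, hab, hbc, h2, lt_of_le_of_ne h3 (π.injective.ne hbc.ne')⟩
  · rintro ⟨a, b, c, hab, hbc, h1, h2⟩
    exact ⟨a, b, c, hab, hbc, h1.trans h2, h1, h2.le⟩

theorem contains_pattern213 {n : ℕ} (π : Equiv.Perm (Fin n)) :
    Contains π pattern213 ↔ ∃ a b c : Fin n, a < b ∧ b < c ∧ π b < π a ∧ π a < π c := by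
  have e1 : ¬ pattern213 0 < pattern213 1 := by decide
  have e2 : pattern213 0 < pattern213 2 := by decide
  have e3 : pattern213 1 < pattern213 2 := by decide
  simp only [contains_iff, e1, e2, e3, iff_false, iff_true, not_lt]
  constructor
  · rintro ⟨a, b, c, hab, hbc, h1, h2, h3⟩
    exact ⟨a, b, c, hab, hbc, lt_of_le_of_ne h1 (π.injective.ne hab.ne'), h2⟩
  · rintro ⟨a, b, c, hab, hbc, h1, h2⟩
    exact ⟨a, b, c, hab, hbc, h1.le, h2, h1.trans h2⟩

/-- The involutions of `{0, …, n - 1}` that avoid `σ` and have `k` fixed points. -/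
def avoidingSet (σ : Equiv.Perm (Fin 3)) (n k : ℕ) : Set (Equiv.Perm (Fin n)) :=
  {π | (∀ x, π (π x) = x) ∧ ¬ Contains π σ ∧ (Finset.univ.filter fun x => π x = x).card = k}

/-- The extension of a permutation of `{0, …, n - 1}` to the naturals by the identity. -/
def extendNat {n : ℕ} (π : Equiv.Perm (Fin n)) : Equiv.Perm ℕ :=
  π.extendDomain Fin.equivSubtype

theorem extendNat_coe {n : ℕ} (π : Equiv.Perm (Fin n)) (x : Fin n) : extendNat π x = π x :=
  π.extendDomain_apply_image Fin.equivSubtype x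

theorem extendNat_of_le {n : ℕ} (π : Equiv.Perm (Fin n)) {x : ℕ} (hx : n ≤ x) :
    extendNat π x = x :=
  π.extendDomain_apply_not_subtype Fin.equivSubtype (not_lt.2 hx)

theorem extendNat_injective (n : ℕ) : Function.Injective (extendNat (n := n)) := by
  intro π τ h
  ext x
  rw [← extendNat_coe, h, extendNat_coe]

theorem exists_extendNat_eq {n : ℕ} {f : Equiv.Perm ℕ} (h1 : ∀ x, f (f x) = x)
    (h2 : ∀ x, n ≤ x → f x = x) : ∃ π : Equiv.Perm (Fin n), extendNat π = f := by
  have hlt : ∀ x : Fin n, f x < n := fun x => by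
    by_contra h
    have := h2 _ (not_lt.1 h)
    rw [h1] at this
    have := x.2
    lia
  refine ⟨⟨fun x => ⟨f x, hlt x⟩, fun x => ⟨f x, hlt x⟩, fun x => by ext; simp [h1],
    fun x => by ext; simp [h1]⟩, ?_⟩
  ext x
  by_cases hx : x < n
  · exact extendNat_coe _ ⟨x, hx⟩
  · rw [extendNat_of_le _ (not_lt.1 hx), h2 _ (not_lt.1 hx)]

theorem extendNat_involutive_iff {n : ℕ} (π : Equiv.Perm (Fin n)) :
    (∀ x, extendNat π (extendNat π x) = x) ↔ ∀ x, π (π x) = x := by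
  constructor
  · intro h x
    ext
    rw [← extendNat_coe, ← extendNat_coe, h]
  · intro h x
    by_cases hx : x < n
    · have := extendNat_coe π ⟨x, hx⟩
      dsimp only at this
      rw [this, extendNat_coe, h]
    · rw [extendNat_of_le _ (not_lt.1 hx), extendNat_of_le _ (not_lt.1 hx)]

theorem card_fixed_extendNat {n : ℕ} (π : Equiv.Perm (Fin n)) :
    ((Finset.range n).filter fun x => extendNat π x = x).card =
      (Finset.univ.filter fun x => π x = x).card := by
  rw [← Finset.card_map Fin.valEmbedding]
  congr 1
  ext x
  simp only [Finset.mem_filter, Finset.mem_range, Finset.mem_map, Finset.mem_univ, true_and,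
    Fin.valEmbedding_apply]
  constructor
  · rintro ⟨hx, h⟩
    refine ⟨⟨x, hx⟩, ?_, rfl⟩
    ext
    rw [← extendNat_coe]
    exact h
  · rintro ⟨a, h, rfl⟩
    exact ⟨a.2, by rw [extendNat_coe, h]⟩

theorem image_extendNat_avoidingSet {σ : Equiv.Perm (Fin 3)} {n k : ℕ} {S : Set (Equiv.Perm ℕ)}
    {Av : Equiv.Perm ℕ → Prop}
    (hS : ∀ f, f ∈ S ↔ (∀ x, f (f x) = x) ∧ (∀ x, n ≤ x → f x = x) ∧ Av f ∧
      ((Finset.range n).filter fun x => f x = x).card = k)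
    (hAv : ∀ π : Equiv.Perm (Fin n), ¬ Contains π σ ↔ Av (extendNat π)) :
    extendNat '' avoidingSet σ n k = S := by
  ext f
  rw [hS]
  constructor
  · rintro ⟨π, ⟨h1, h2, h3⟩, rfl⟩
    exact ⟨(extendNat_involutive_iff π).2 h1, fun x => extendNat_of_le π, (hAv π).1 h2,
      (card_fixed_extendNat π).trans h3⟩
  · rintro ⟨h1, h2, h3, h4⟩
    obtain ⟨π, rfl⟩ := exists_extendNat_eq h1 h2
    exact ⟨π, ⟨(extendNat_involutive_iff π).1 h1, (hAv π).2 h3,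
      (card_fixed_extendNat π).symm.trans h4⟩, rfl⟩

theorem encard_avoidingSet_pattern321 (n k : ℕ) :
    (avoidingSet pattern321 n k).encard = ballot n k := by
  rw [← (extendNat_injective n).injOn.encard_image, image_extendNat_avoidingSet
    (S := involutions321 n ∅ k) (Av := fun f => ∀ a b c, a < n → b < n → c < n → a < b → b < c →
      f b < f a → f c < f b → False), encard_involutions321 n ∅ k (by simp)]
  · simp
  · intro f
    simp [involutions321]
  · intro π
    rw [contains_pattern321]
    constructor
    · intro h a b c ha hb hc hab hbc h1 h2
      refine h ⟨⟨a, ha⟩, ⟨b, hb⟩, ⟨c, hc⟩, hab, hbc, ?_, ?_⟩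
      · rw [Fin.lt_def, ← extendNat_coe, ← extendNat_coe]; exact h1
      · rw [Fin.lt_def, ← extendNat_coe, ← extendNat_coe]; exact h2
    · rintro h ⟨a, b, c, hab, hbc, h1, h2⟩
      refine h a b c a.2 b.2 c.2 hab hbc ?_ ?_
      · rw [extendNat_coe, extendNat_coe]; exact h1
      · rw [extendNat_coe, extendNat_coe]; exact h2

theorem encard_avoidingSet_pattern132 (n k : ℕ) :
    (avoidingSet pattern132 n k).encard = ballot n k := by
  rw [← (extendNat_injective n).injOn.encard_image, image_extendNat_avoidingSet
    (S := involutions132 n k) (Av := fun f => ∀ a b c, a < b → b < c → c < n →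
      f a < f c → f c < f b → False), encard_involutions132 n k]
  · intro f
    simp [involutions132]
  · intro π
    rw [contains_pattern132]
    constructor
    · intro h a b c hab hbc hc h1 h2
      refine h ⟨⟨a, by lia⟩, ⟨b, by lia⟩, ⟨c, hc⟩, hab, hbc, ?_, ?_⟩
      · rw [Fin.lt_def, ← extendNat_coe, ← extendNat_coe]; exact h1
      · rw [Fin.lt_def, ← extendNat_coe, ← extendNat_coe]; exact h2
    · rintro h ⟨a, b, c, hab, hbc, h1, h2⟩
      refine h a b c hab hbc c.2 ?_ ?_
      · rw [extendNat_coe, extendNat_coe]; exact h1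
      · rw [extendNat_coe, extendNat_coe]; exact h2

theorem revPerm_conj_mem_avoidingSet {n k : ℕ} {σ τ : Equiv.Perm (Fin 3)}
    (h : ∀ π : Equiv.Perm (Fin n), Contains (Fin.revPerm * π * Fin.revPerm) τ → Contains π σ)
    {π : Equiv.Perm (Fin n)} (hπ : π ∈ avoidingSet σ n k) :
    Fin.revPerm * π * Fin.revPerm ∈ avoidingSet τ n k := by
  obtain ⟨h1, h2, h3⟩ := hπ
  refine ⟨fun x => by simp [h1], fun h4 => h2 (h π h4), ?_⟩
  rw [← h3, ← Finset.card_map Fin.revPerm.toEmbedding]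
  congr 1
  ext x
  simp only [Finset.mem_map, Finset.mem_filter, Finset.mem_univ, true_and]
  constructor
  · rintro ⟨a, ha, rfl⟩
    have := congrArg Fin.rev ha
    simpa using this
  · intro hx
    exact ⟨Fin.rev x, by simp [hx], by simp⟩

/-- Conjugation by the order reversal reverses both positions and values, which turns 132 into 213
and keeps the number of fixed points. -/
theorem encard_avoidingSet_pattern213 (n k : ℕ) :
    (avoidingSet pattern213 n k).encard = ballot n k := by
  have hinj : Function.Injective fun π : Equiv.Perm (Fin n) => Fin.revPerm * π * Fin.revPerm :=
    fun π τ h => by simpa using h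
  have hinv : ∀ π : Equiv.Perm (Fin n),
      Fin.revPerm * (Fin.revPerm * π * Fin.revPerm) * Fin.revPerm = π := fun π => by
    ext x; simp
  rw [← encard_avoidingSet_pattern132, ← hinj.injOn.encard_image]
  congr 1
  ext π
  constructor
  · rintro ⟨π, hπ, rfl⟩
    refine revPerm_conj_mem_avoidingSet (fun π => ?_) hπ
    rw [contains_pattern132, contains_pattern213]
    rintro ⟨a, b, c, hab, hbc, h1, h2⟩
    refine ⟨Fin.rev c, Fin.rev b, Fin.rev a, Fin.rev_lt_rev.2 hbc, Fin.rev_lt_rev.2 hab, ?_, ?_⟩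
    · simpa [Fin.rev_lt_rev] using h2
    · simpa [Fin.rev_lt_rev] using h1
  · intro hπ
    refine ⟨_, revPerm_conj_mem_avoidingSet (fun π => ?_) hπ, hinv π⟩
    rw [contains_pattern132, contains_pattern213]
    rintro ⟨a, b, c, hab, hbc, h1, h2⟩
    refine ⟨Fin.rev c, Fin.rev b, Fin.rev a, Fin.rev_lt_rev.2 hbc, Fin.rev_lt_rev.2 hab, ?_, ?_⟩
    · simpa [Fin.rev_lt_rev] using h2
    · simpa [Fin.rev_lt_rev] using h1

theorem encard_avoidingSet {σ : Equiv.Perm (Fin 3)}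
    (hσ : σ = pattern321 ∨ σ = pattern132 ∨ σ = pattern213) (n k : ℕ) :
    (avoidingSet σ n k).encard = ballot n k := by
  rcases hσ with rfl | rfl | rfl
  · exact encard_avoidingSet_pattern321 n k
  · exact encard_avoidingSet_pattern132 n k
  · exact encard_avoidingSet_pattern213 n k

theorem card_filter_fp_eq {σ : Equiv.Perm (Fin 3)}
    (hσ : σ = pattern321 ∨ σ = pattern132 ∨ σ = pattern213) (n k : ℕ) :
    (Finset.univ.filter fun π : AvoidingInvolution σ n => fp π = k).card = ballot n k := by
  have h := encard_avoidingSet hσ n k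
  have e : avoidingSet σ n k = (fun π : AvoidingInvolution σ n => π.1) ''
      ((Finset.univ.filter fun π : AvoidingInvolution σ n => fp π = k : Finset _) : Set _) := by
    ext π
    simp only [Finset.coe_filter, Finset.mem_univ, true_and]
    constructor
    · rintro ⟨h1, h2, h3⟩
      exact ⟨⟨π, h1, h2⟩, h3, rfl⟩
    · rintro ⟨⟨π, h1, h2⟩, h3, rfl⟩
      exact ⟨h1, h2, h3⟩
  have hinj : Function.Injective fun π : AvoidingInvolution σ n => π.1 :=
    fun _ _ h => Subtype.ext h
  rw [e, hinj.injOn.encard_image, Set.encard_coe_eq_coe_finsetCard] at h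
  exact_mod_cast h

/-! ### Ballot numbers -/

theorem ballot_eq_zero_of_lt {n k : ℕ} (h : n < k) : ballot n k = 0 := by
  induction n generalizing k with
  | zero => simp [ballot, h.ne']
  | succ n ih =>
    obtain ⟨k, rfl⟩ : ∃ l, k = l + 1 := ⟨k - 1, by lia⟩
    rw [ballot, ih (by lia), ih (by lia)]

theorem ballot_eq_zero_of_odd {n k : ℕ} (h : (n + k) % 2 = 1) : ballot n k = 0 := by
  induction n generalizing k with
  | zero =>
    have : k ≠ 0 := by lia
    simp [ballot, this]
  | succ n ih =>
    cases k with
    | zero => rw [ballot, ih (by lia)]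
    | succ k => rw [ballot, ih (by lia), ih (by lia)]

theorem ballot_self (n : ℕ) : ballot n n = 1 := by
  induction n with
  | zero => rfl
  | succ n ih => rw [ballot, ih, ballot_eq_zero_of_lt (by lia)]

/-- The reflection principle, proved from Pascal's rule: paths to `k` that leave the nonnegative
half-line are counted by `C(n, j)`. -/
theorem ballot_add_choose (n k j : ℕ) (h : n = k + 2 * (j + 1)) :
    ballot n k + n.choose j = n.choose (j + 1) := by
  induction n generalizing k j with
  | zero => lia
  | succ n ih =>
    cases k with
    | zero =>
      rw [ballot]
      cases j with
      | zero =>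
        obtain rfl : n = 1 := by lia
        rfl
      | succ i =>
        have h1 := ih 1 i (by lia)
        -- At the boundary `n = 2i + 3`, so the two middle binomial coefficients agree and the
        -- missing neighbour of `0` contributes nothing.
        have h2 : n.choose (i + 1 + 1) = n.choose (i + 1) := Nat.choose_symm_of_eq_add (by lia)
        rw [Nat.choose_succ_succ' n i, Nat.choose_succ_succ' n (i + 1)]
        lia
    | succ k =>
      rw [ballot]
      have h1 := ih k j (by lia)
      cases j with
      | zero =>
        have h2 : ballot n (k + 2) = 1 := by
          rw [show k + 2 = n by lia, ballot_self]
        simp only [Nat.choose_zero_right, zero_add, Nat.choose_one_right] at *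
        lia
      | succ i =>
        have h2 := ih (k + 2) i (by lia)
        rw [Nat.choose_succ_succ' n i, Nat.choose_succ_succ' n (i + 1)]
        lia

theorem ballot_succ_eq_sub (n i : ℕ) (h : 2 * (i + 1) ≤ n) :
    (ballot n (n - 2 * (i + 1)) : ℝ) = n.choose (i + 1) - n.choose i := by
  have := ballot_add_choose n (n - 2 * (i + 1)) i (by lia)
  rw [eq_sub_iff_add_eq]
  exact_mod_cast this

/-- The differences of binomials telescope, so at `q = 1` tail counts are single binomial
coefficients. -/
theorem sum_ballot (n j : ℕ) (h : 2 * j ≤ n) :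
    ∑ i ∈ Finset.range (j + 1), (ballot n (n - 2 * i) : ℝ) = n.choose j := by
  induction j with
  | zero => simp [ballot_self]
  | succ j ih =>
    rw [Finset.sum_range_succ, ih (by lia), ballot_succ_eq_sub n j h]
    ring

/-- The product form of the ballot numbers exhibits the factor `k + 1` of the negative binomial
weights, with `k = n - 2i`. -/
theorem ballot_mul (n i : ℕ) (h : 2 * i ≤ n) :
    (n + 1 : ℝ) * ballot n (n - 2 * i) = (n - 2 * i + 1) * (n + 1).choose i := by
  cases i with
  | zero => simp [ballot_self]
  | succ i =>
    rw [ballot_succ_eq_sub n i h]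
    have h1 := Nat.add_one_mul_choose_eq n i
    have h2 := Nat.choose_succ_right_eq n i
    have h1' : (n + 1 : ℝ) * n.choose i = (n + 1).choose (i + 1) * (i + 1) := by exact_mod_cast h1
    have h2' : (n.choose (i + 1) : ℝ) * (i + 1) = n.choose i * (n - i) := by
      rw [← Nat.cast_sub (by lia)]
      exact_mod_cast h2
    have hi : (i + 1 : ℝ) ≠ 0 := by positivity
    have h3 : ((n + 1).choose (i + 1) : ℝ) = (n + 1) * n.choose i / (i + 1) := by
      rw [eq_div_iff hi, h1']
    have h4 : (n.choose (i + 1) : ℝ) = n.choose i * (n - i) / (i + 1) := by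
      rw [eq_div_iff hi, h2']
    rw [h3, h4]
    push_cast
    field_simp
    ring

/-! ### The law of the number of fixed points -/

theorem sum_fp_eq {E : Type*} [AddCommMonoid E] {σ : Equiv.Perm (Fin 3)}
    (hσ : σ = pattern321 ∨ σ = pattern132 ∨ σ = pattern213) (n : ℕ) (F : ℕ → E) :
    ∑ π : AvoidingInvolution σ n, F (fp π) =
      ∑ i ∈ Finset.range (n / 2 + 1), ballot n (n - 2 * i) • F (n - 2 * i) := by
  have hfp : ∀ π : AvoidingInvolution σ n, fp π ∈ Finset.range (n + 1) := fun π => by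
    rw [Finset.mem_range, Nat.lt_succ_iff]
    exact (Finset.card_filter_le _ _).trans (by simp)
  rw [← Finset.sum_fiberwise_of_maps_to (fun π _ => hfp π)]
  have h1 : ∀ k ∈ Finset.range (n + 1), ∑ π : AvoidingInvolution σ n with fp π = k, F (fp π) =
      ballot n k • F k := fun k _ => by
    rw [Finset.sum_congr rfl (g := fun _ => F k)
      (fun π hπ => by rw [(Finset.mem_filter.1 hπ).2]), Finset.sum_const, card_filter_fp_eq hσ]
  rw [Finset.sum_congr rfl h1]
  symm
  refine Finset.sum_of_injOn (fun i => n - 2 * i) ?_ ?_ ?_ ?_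
  · intro a ha b hb hab
    simp only [Finset.coe_range, Set.mem_Iio] at ha hb hab
    lia
  · intro a ha
    simp only [Finset.coe_range, Set.mem_Iio] at ha ⊢
    lia
  · intro k hk hk'
    rw [ballot_eq_zero_of_odd, zero_smul]
    by_contra h
    refine hk' ⟨(n - k) / 2, ?_, ?_⟩
    · simp only [Finset.coe_range, Set.mem_Iio]
      lia
    · have := Finset.mem_range.1 hk
      dsimp only
      lia
  · exact fun _ _ => rfl

instance {σ : Equiv.Perm (Fin 3)} {n : ℕ} : DiscreteMeasurableSpace (AvoidingInvolution σ n) :=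
  ⟨fun _ => trivial⟩

/-- The total weight of the involutions of length `n`. -/
def partitionFunction (q : ℝ) (n : ℕ) : ℝ :=
  ∑ i ∈ Finset.range (n / 2 + 1), (ballot n (n - 2 * i) : ℝ) * q ^ (n - 2 * i)

theorem partitionFunction_pos {q : ℝ} (hq : 0 < q) (n : ℕ) : 0 < partitionFunction q n := by
  refine Finset.sum_pos' (fun i _ => by positivity) ⟨0, by simp, ?_⟩
  simp only [mul_zero, Nat.sub_zero, ballot_self]
  positivity

/-- The target `E` is kept general so that the formula serves real test functions and complex
exponentials alike. -/
theorem integral_fp_biasedMeasure {E : Type*} [NormedAddCommGroup E] [NormedSpace ℝ E]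
    [CompleteSpace E] {σ : Equiv.Perm (Fin 3)} (hσ : σ = pattern321 ∨ σ = pattern132 ∨ σ = pattern213) {q : ℝ}
    (hq : 0 < q) (n : ℕ) (F : ℕ → E) :
    ∫ π, F (fp π) ∂biasedMeasure q σ n = (partitionFunction q n)⁻¹ •
      ∑ i ∈ Finset.range (n / 2 + 1),
        ((ballot n (n - 2 * i) : ℝ) * q ^ (n - 2 * i)) • F (n - 2 * i) := by
  have hZ : ∑ τ : AvoidingInvolution σ n, q ^ fp τ = partitionFunction q n := by
    rw [sum_fp_eq hσ n (fun k => q ^ k), partitionFunction]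
    simp
  rw [biasedMeasure, integral_finsetSum_measure]
  · simp only [integral_smul_measure, integral_dirac]
    have hnn : ∀ k, 0 ≤ q ^ k / partitionFunction q n := fun k =>
      div_nonneg (by positivity) (partitionFunction_pos hq n).le
    simp only [hZ, ENNReal.toReal_ofReal (hnn _)]
    rw [sum_fp_eq hσ n (fun k => (q ^ k / partitionFunction q n) • F k), Finset.smul_sum]
    refine Finset.sum_congr rfl fun i _ => ?_
    rw [← Nat.cast_smul_eq_nsmul ℝ, smul_smul, smul_smul]
    congr 1
    ring
  · intro π _
    have : IsFiniteMeasure (ENNReal.ofReal (q ^ fp π / ∑ τ : AvoidingInvolution σ n, q ^ fp τ) •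
        Measure.dirac π) := Measure.smul_finite _ ENNReal.ofReal_ne_top
    exact Integrable.of_finite

theorem integral_fp {E : Type*} [NormedAddCommGroup E] [NormedSpace ℝ E]
    [CompleteSpace E] {σ : Equiv.Perm (Fin 3)} (hσ : σ = pattern321 ∨ σ = pattern132 ∨ σ = pattern213) {q : ℝ}
    (hq : 0 < q) {n : ℕ} {Ω : Type*} [MeasurableSpace Ω] {P : Measure Ω}
    {X : Ω → AvoidingInvolution σ n} (hX : HasLaw X (biasedMeasure q σ n) P) (F : ℕ → E) :
    ∫ ω, F (fp (X ω)) ∂P = (partitionFunction q n)⁻¹ •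
      ∑ i ∈ Finset.range (n / 2 + 1),
        ((ballot n (n - 2 * i) : ℝ) * q ^ (n - 2 * i)) • F (n - 2 * i) := by
  rw [← integral_fp_biasedMeasure hσ hq, ← hX.map_eq, integral_map hX.aemeasurable .of_discrete]

/-! ### Binomial coefficients near the middle -/

/-- Each step down from `c - i` multiplies the coefficient by at most `1 - (2i + 1) / (n - c + s)`,
hence by at most the exponential, and the odd numbers `2i + 1` with `i < s` add up to `s²`. -/
theorem choose_sub_le_mul_exp {n c s : ℕ} (hc : 2 * c ≤ n) (hs : s ≤ c) :
    (n.choose (c - s) : ℝ) ≤ n.choose c * Real.exp (-(s : ℝ) ^ 2 / (n - c + s)) := by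
  -- The denominator is frozen at its value for `s` while `i` varies, so that the exponents simply
  -- add.
  suffices h : ∀ i ≤ s,
      (n.choose (c - i) : ℝ) ≤ n.choose c * Real.exp (-(i : ℝ) ^ 2 / (n - c + s)) from h s le_rfl
  intro i
  induction i with
  | zero => simp
  | succ i ih =>
    intro hi
    have h1 := ih (by lia)
    obtain ⟨k, hk⟩ : ∃ k, c = k + 1 + i := ⟨c - 1 - i, by lia⟩
    have h2 := Nat.choose_succ_right_eq n k
    have h3 : (n.choose (k + 1) : ℝ) * (k + 1) = n.choose k * (n - k) := by
      rw [← Nat.cast_sub (by lia)]; exact_mod_cast h2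
    rw [show c - i = k + 1 by lia] at h1
    rw [show c - (i + 1) = k by lia]
    have hcR : (2 * c : ℝ) ≤ n := by exact_mod_cast hc
    have hiR : (i + 1 : ℝ) ≤ s := by exact_mod_cast hi
    have hkR : (c : ℝ) = k + 1 + i := by rw [hk]; push_cast; ring
    have hk0 : (0 : ℝ) ≤ k := Nat.cast_nonneg k
    have hi0 : (0 : ℝ) ≤ i := Nat.cast_nonneg i
    have hnk : 0 < (n - k : ℝ) := by linarith
    have hD : 0 < (n - c + s : ℝ) := by linarith
    have h4 : (k + 1) / (n - k : ℝ) ≤ Real.exp (-(2 * i + 1) / (n - c + s)) := by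
      calc (k + 1) / (n - k : ℝ) ≤ -(2 * i + 1) / (n - c + s) + 1 := by
            rw [div_add_one hD.ne', div_le_div_iff₀ hnk hD]
            nlinarith
        _ ≤ _ := Real.add_one_le_exp _
    have h5 : (n.choose k : ℝ) = n.choose (k + 1) * ((k + 1) / (n - k : ℝ)) := by
      rw [mul_div_assoc', h3, mul_div_cancel_right₀ _ hnk.ne']
    calc (n.choose k : ℝ) = n.choose (k + 1) * ((k + 1) / (n - k : ℝ)) := h5
      _ ≤ (n.choose c * Real.exp (-(i : ℝ) ^ 2 / (n - c + s))) *
          Real.exp (-(2 * i + 1) / (n - c + s)) := by gcongr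
      _ = n.choose c * Real.exp (-((i + 1 : ℕ) : ℝ) ^ 2 / (n - c + s)) := by
        rw [mul_assoc, ← Real.exp_add]
        congr 2
        push_cast
        ring

/-- The matching lower bound comes from the reciprocal ratio `1 + (n - 2c + 2i + 1) / (c - i)`,
whose denominator is at least `c + 1 - s`. -/
theorem choose_mul_exp_le_choose_sub {n c s : ℕ} (hc : 2 * c ≤ n) (hs : s ≤ c) :
    (n.choose c : ℝ) * Real.exp (-((s : ℝ) ^ 2 + (n - 2 * c) * s) / (c + 1 - s)) ≤
      n.choose (c - s) := by
  suffices h : ∀ i ≤ s,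
      (n.choose c : ℝ) * Real.exp (-((i : ℝ) ^ 2 + (n - 2 * c) * i) / (c + 1 - s)) ≤
        n.choose (c - i) from h s le_rfl
  intro i
  induction i with
  | zero => simp
  | succ i ih =>
    intro hi
    have h1 := ih (by lia)
    obtain ⟨k, hk⟩ : ∃ k, c = k + 1 + i := ⟨c - 1 - i, by lia⟩
    have h2 := Nat.choose_succ_right_eq n k
    have h3 : (n.choose (k + 1) : ℝ) * (k + 1) = n.choose k * (n - k) := by
      rw [← Nat.cast_sub (by lia)]; exact_mod_cast h2
    rw [show c - i = k + 1 by lia] at h1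
    rw [show c - (i + 1) = k by lia]
    have hcR : (2 * c : ℝ) ≤ n := by exact_mod_cast hc
    have hiR : (i + 1 : ℝ) ≤ s := by exact_mod_cast hi
    have hsR : (s : ℝ) ≤ c := by exact_mod_cast hs
    have hkR : (c : ℝ) = k + 1 + i := by rw [hk]; push_cast; ring
    have hk0 : (0 : ℝ) ≤ k := Nat.cast_nonneg k
    have hi0 : (0 : ℝ) ≤ i := Nat.cast_nonneg i
    have hL : 0 < (c + 1 - s : ℝ) := by linarith
    have hk1 : (0 : ℝ) < k + 1 := by linarith
    have h4 : (n - k : ℝ) / (k + 1) ≤ Real.exp ((n - 2 * c + 2 * i + 1) / (c + 1 - s)) := by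
      calc (n - k : ℝ) / (k + 1) ≤ (n - 2 * c + 2 * i + 1) / (c + 1 - s) + 1 := by
            rw [div_add_one hL.ne', div_le_div_iff₀ hk1 hL]
            nlinarith
        _ ≤ _ := Real.add_one_le_exp _
    have h5 : (n.choose (k + 1) : ℝ) = n.choose k * ((n - k : ℝ) / (k + 1)) := by
      rw [mul_div_assoc', ← h3, mul_div_cancel_right₀ _ hk1.ne']
    have h6 : (n.choose (k + 1) : ℝ) ≤
        n.choose k * Real.exp ((n - 2 * c + 2 * i + 1) / (c + 1 - s)) := by
      rw [h5]; gcongr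
    have h7 := h1.trans h6
    rw [← div_le_iff₀ (Real.exp_pos _), mul_div_assoc, ← Real.exp_sub] at h7
    convert! h7 using 3
    push_cast
    ring

theorem tendsto_choose_sub_div (u : ℕ → ℕ) (d s : ℕ) (hu : ∀ n, u n = 2 * n + d) :
    Tendsto (fun n => ((u n).choose (n - s) : ℝ) / (u n).choose n) atTop (𝓝 1) := by
  have hlow : Tendsto (fun n : ℕ => Real.exp (-((s : ℝ) ^ 2 + d * s) / (n + 1 - s))) atTop
      (𝓝 1) := by
    rw [← Real.exp_zero]
    refine (Real.continuous_exp.tendsto 0).comp ?_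
    refine Tendsto.div_atTop tendsto_const_nhds ?_
    simp_rw [add_sub_assoc]
    exact tendsto_atTop_add_const_right _ _ tendsto_natCast_atTop_atTop
  refine tendsto_of_tendsto_of_tendsto_of_le_of_le' hlow tendsto_const_nhds ?_ ?_
  · filter_upwards [eventually_ge_atTop s] with n hn
    have hpos : (0 : ℝ) < (u n).choose n := by
      exact_mod_cast Nat.choose_pos (by rw [hu]; lia)
    rw [le_div_iff₀ hpos, mul_comm]
    convert! choose_mul_exp_le_choose_sub (n := u n) (c := n) (by rw [hu]; lia) hn using 5
    rw [hu]; push_cast; ring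
  · filter_upwards [eventually_ge_atTop s] with n hn
    have hpos : (0 : ℝ) < (u n).choose n := by
      exact_mod_cast Nat.choose_pos (by rw [hu]; lia)
    rw [div_le_one hpos]
    refine (choose_sub_le_mul_exp (n := u n) (c := n) (by rw [hu]; lia) hn).trans ?_
    refine mul_le_of_le_one_right hpos.le (Real.exp_le_one_iff.2 ?_)
    refine div_nonpos_of_nonpos_of_nonneg (by simp) ?_
    rw [hu]
    push_cast
    have : (0 : ℝ) ≤ n := Nat.cast_nonneg n
    have : (0 : ℝ) ≤ d := Nat.cast_nonneg d
    have : (0 : ℝ) ≤ s := Nat.cast_nonneg s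
    linarith

/-! ### The subcritical regime -/

theorem summable_succ_mul_pow {q : ℝ} (hq : 0 < q) (hq1 : q < 1) :
    Summable fun k : ℕ => (k + 1 : ℝ) * q ^ k := by
  have h1 := summable_pow_mul_geometric_of_norm_lt_one 1 (r := q)
    (by rwa [Real.norm_of_nonneg hq.le])
  have h2 := summable_geometric_of_lt_one hq.le hq1
  refine (h1.add h2).congr fun k => ?_
  ring

theorem summable_succ_mul_pow_parity {q : ℝ} (hq : 0 < q) (hq1 : q < 1) (e : ℕ) :
    Summable fun l : ℕ => ((2 * l + e : ℕ) + 1 : ℝ) * q ^ (2 * l + e) :=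
  (summable_succ_mul_pow hq hq1).comp_injective (i := fun l => 2 * l + e) fun a b h => by
    dsimp only at h; lia

/-- Setting `i = n - l` indexes the sum by the number `2l + e` of fixed points. The prefactor is
independent of `l` and cancels in expectations; the series over all `l` is the form needed for
dominated convergence. -/
theorem sum_ballot_reflect (q : ℝ) {e : ℕ} (he : e < 2) (F : ℕ → ℝ) (n : ℕ) :
    ∑ i ∈ Finset.range ((2 * n + e) / 2 + 1), ((ballot (2 * n + e) (2 * n + e - 2 * i) : ℝ) *
        q ^ (2 * n + e - 2 * i)) * F (2 * n + e - 2 * i) =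
      ((2 * n + e + 1).choose n : ℝ) / (2 * n + e + 1) *
        ∑' l, if l ≤ n then ((2 * l + e : ℕ) + 1 : ℝ) * q ^ (2 * l + e) * F (2 * l + e) *
          (((2 * n + e + 1).choose (n - l) : ℝ) / (2 * n + e + 1).choose n) else 0 := by
  have hpos : (0 : ℝ) < (2 * n + e + 1).choose n := by
    exact_mod_cast Nat.choose_pos (by lia)
  have hN : (0 : ℝ) < 2 * n + e + 1 := by positivity
  rw [tsum_eq_sum (s := Finset.range (n + 1)) (fun l hl => if_neg (by simpa using hl)),
    show (2 * n + e) / 2 = n by lia, ← Finset.sum_range_reflect, Finset.mul_sum]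
  refine Finset.sum_congr rfl fun l hl => ?_
  have hl' : l ≤ n := Nat.lt_succ_iff.1 (Finset.mem_range.1 hl)
  rw [if_pos hl']
  have h1 := ballot_mul (2 * n + e) (n - l) (by lia)
  rw [show n + 1 - 1 - l = n - l by lia]
  rw [show 2 * n + e - 2 * (n - l) = 2 * l + e by lia] at h1 ⊢
  have h2 : (ballot (2 * n + e) (2 * l + e) : ℝ) =
      (2 * l + e + 1) * (2 * n + e + 1).choose (n - l) / (2 * n + e + 1) := by
    rw [eq_div_iff hN.ne', mul_comm]
    push_cast [Nat.cast_sub hl'] at h1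
    rw [h1]
    ring
  rw [h2]
  push_cast
  field_simp

theorem tendsto_integral_fp_of_lt_one {σ : Equiv.Perm (Fin 3)}
    (hσ : σ = pattern321 ∨ σ = pattern132 ∨ σ = pattern213) {q : ℝ} (hq : 0 < q) (hq1 : q < 1)
    {e : ℕ} (he : e < 2) {Ω : ℕ → Type*} [∀ n, MeasurableSpace (Ω n)] {P : ∀ n, Measure (Ω n)}
    {X : ∀ n, Ω n → AvoidingInvolution σ n} (hX : ∀ n, HasLaw (X n) (biasedMeasure q σ n) (P n))
    {F : ℕ → ℝ} {C : ℝ} (hF : ∀ k, |F k| ≤ C) :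
    Tendsto (fun n => ∫ ω, F (fp (X (2 * n + e) ω)) ∂P (2 * n + e)) atTop
      (𝓝 ((∑' l : ℕ, ((2 * l + e : ℕ) + 1 : ℝ) * q ^ (2 * l + e))⁻¹ *
        ∑' l : ℕ, ((2 * l + e : ℕ) + 1 : ℝ) * q ^ (2 * l + e) * F (2 * l + e))) := by
  have hlim : ∀ (F : ℕ → ℝ) (C : ℝ), (∀ k, |F k| ≤ C) → Tendsto (fun n =>
      ∑' l, if l ≤ n then ((2 * l + e : ℕ) + 1 : ℝ) * q ^ (2 * l + e) * F (2 * l + e) *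
          (((2 * n + e + 1).choose (n - l) : ℝ) / (2 * n + e + 1).choose n) else 0) atTop
      (𝓝 (∑' l : ℕ, ((2 * l + e : ℕ) + 1 : ℝ) * q ^ (2 * l + e) * F (2 * l + e))) := by
    intro F C hF
    have hC : 0 ≤ C := (abs_nonneg _).trans (hF 0)
    refine tendsto_tsum_of_dominated_convergence
      ((summable_succ_mul_pow_parity hq hq1 e).mul_right C) ?_ ?_
    · intro l
      have h1 := (tendsto_choose_sub_div (fun n => 2 * n + e + 1) (e + 1) l
        (fun n => by ring)).const_mul (((2 * l + e : ℕ) + 1 : ℝ) * q ^ (2 * l + e) * F (2 * l + e))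
      rw [mul_one] at h1
      refine h1.congr' ?_
      filter_upwards [eventually_ge_atTop l] with n hn
      rw [if_pos hn]
    · refine Eventually.of_forall fun n l => ?_
      split_ifs with h
      · have hpos : (0 : ℝ) < (2 * n + e + 1).choose n := by
          exact_mod_cast Nat.choose_pos (by lia)
        have h2 : ((2 * n + e + 1).choose (n - l) : ℝ) / (2 * n + e + 1).choose n ≤ 1 := by
          rw [div_le_one hpos]
          refine (choose_sub_le_mul_exp (by lia) h).trans ?_
          refine mul_le_of_le_one_right hpos.le (Real.exp_le_one_iff.2 ?_)
          refine div_nonpos_of_nonpos_of_nonneg (by simp) ?_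
          push_cast
          have : (0 : ℝ) ≤ n + e + l := by positivity
          linarith
        rw [norm_mul, norm_mul, Real.norm_of_nonneg (by positivity),
          Real.norm_of_nonneg (by positivity : (0 : ℝ) ≤ _ / _), Real.norm_eq_abs]
        calc _ ≤ ((2 * l + e : ℕ) + 1 : ℝ) * q ^ (2 * l + e) * C * 1 := by
              gcongr
              exact hF _
          _ = _ := mul_one _
      · rw [norm_zero]; positivity
  -- The constant function gives the limit of the partition function, up to the common prefactor.
  have h1 := hlim (fun _ => 1) 1 (by simp)
  have h2 := hlim F C hF
  simp only [mul_one] at h1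
  have hpos : 0 < ∑' l : ℕ, ((2 * l + e : ℕ) + 1 : ℝ) * q ^ (2 * l + e) :=
    (summable_succ_mul_pow_parity hq hq1 e).tsum_pos (fun l => by positivity) 0 (by positivity)
  refine ((h1.inv₀ hpos.ne').mul h2).congr fun n => ?_
  rw [integral_fp hσ hq (hX _) F, smul_eq_mul]
  simp only [smul_eq_mul]
  have h3 := sum_ballot_reflect q he (fun _ => 1) n
  have h4 := sum_ballot_reflect q he F n
  simp only [mul_one] at h3
  rw [partitionFunction, h3, h4]
  have hc : (((2 * n + e + 1).choose n : ℝ) / (2 * n + e + 1)) ≠ 0 := by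
    have : (0 : ℝ) < (2 * n + e + 1).choose n := by
      exact_mod_cast Nat.choose_pos (by lia)
    positivity
  rw [mul_inv, mul_mul_mul_comm, inv_mul_cancel₀ hc, one_mul]

theorem negBinomial_two_singleton {q : ℝ} (k : ℕ) :
    negBinomial 2 (1 - q) {k} = ENNReal.ofReal ((k + 1) * q ^ k * (1 - q) ^ 2) := by
  rw [negBinomial, Measure.sum_apply _ (measurableSet_singleton k), tsum_eq_single k]
  · simp [Nat.choose_succ_self_right]
  · intro j hj
    simp [hj]

/-- Finiteness is enough, since only the conditioned, hence renormalised, measure is used. -/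
theorem isFiniteMeasure_negBinomial_two {q : ℝ} (hq : 0 < q) (hq1 : q < 1) :
    IsFiniteMeasure (negBinomial 2 (1 - q)) := by
  refine ⟨?_⟩
  rw [← Measure.tsum_indicator_apply_singleton _ _ MeasurableSet.univ]
  simp only [Set.indicator_univ, negBinomial_two_singleton]
  exact ((summable_succ_mul_pow hq hq1).mul_right _).tsum_ofReal_lt_top

/-- The integral of a bounded function against the negative binomial law conditioned to have a
given parity. -/
theorem integral_cond_negBinomial_two {q : ℝ} (hq : 0 < q) (hq1 : q < 1) {e : ℕ}
    {s : Set ℕ} (hs : s = Set.range fun l => 2 * l + e) {F : ℕ → ℝ} {C : ℝ}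
    (hF : ∀ k, |F k| ≤ C) [IsProbabilityMeasure ((negBinomial 2 (1 - q))[|s])] :
    ∫ k, F k ∂(negBinomial 2 (1 - q))[|s] =
      (∑' l : ℕ, ((2 * l + e : ℕ) + 1 : ℝ) * q ^ (2 * l + e))⁻¹ *
        ∑' l : ℕ, ((2 * l + e : ℕ) + 1 : ℝ) * q ^ (2 * l + e) * F (2 * l + e) := by
  have := isFiniteMeasure_negBinomial_two hq hq1
  have hinj : Function.Injective fun l => 2 * l + e := fun a b h => by dsimp only at h; lia
  have hcond : ∀ t : Set ℕ, ((negBinomial 2 (1 - q))[|s]).real t =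
      ((negBinomial 2 (1 - q)).real s)⁻¹ * (negBinomial 2 (1 - q)).real (s ∩ t) := fun t => by
    rw [measureReal_def, cond_apply (hs ▸ MeasurableSet.of_discrete), ENNReal.toReal_mul,
      ENNReal.toReal_inv]
    rfl
  have key : ∀ (F : ℕ → ℝ) (C : ℝ), (∀ k, |F k| ≤ C) → ∫ k, F k ∂(negBinomial 2 (1 - q))[|s] =
      (((negBinomial 2 (1 - q)).real s)⁻¹ * (1 - q) ^ 2) *
        ∑' l : ℕ, ((2 * l + e : ℕ) + 1 : ℝ) * q ^ (2 * l + e) * F (2 * l + e) := by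
    intro F C hF
    rw [integral_countable]
    · rw [← hinj.tsum_eq, ← tsum_mul_left]
      · refine tsum_congr fun l => ?_
        have hmem : 2 * l + e ∈ s := hs ▸ ⟨l, rfl⟩
        rw [hcond,
          Set.inter_eq_right.2 (Set.singleton_subset_iff.2 hmem),
          measureReal_def (s := {2 * l + e}), negBinomial_two_singleton, ENNReal.toReal_ofReal (by positivity), smul_eq_mul]
        ring
      · intro k hk
        rw [← hs]
        by_contra h
        refine hk ?_
        dsimp only
        rw [hcond,
          Set.inter_singleton_eq_empty.2 h]
        simp
    · exact Integrable.of_bound .of_discrete C (Eventually.of_forall hF)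
  -- Total mass one identifies the normalising constant as the inverse of the series.
  have h1 := key (fun _ => 1) 1 (by simp)
  simp only [integral_const, probReal_univ, smul_eq_mul, mul_one] at h1
  rw [key F C hF, ← eq_inv_of_mul_eq_one_left h1.symm]

theorem convergesInLaw_of_lt_one {σ : Equiv.Perm (Fin 3)}
    (hσ : σ = pattern321 ∨ σ = pattern132 ∨ σ = pattern213) {q : ℝ} (hq : 0 < q) (hq1 : q < 1)
    {e : ℕ} (he : e < 2) {Ω : ℕ → Type*} [∀ n, MeasurableSpace (Ω n)] {P : ∀ n, Measure (Ω n)}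
    [∀ n, IsProbabilityMeasure (P n)]
    {X : ∀ n, Ω n → AvoidingInvolution σ n} (hX : ∀ n, HasLaw (X n) (biasedMeasure q σ n) (P n))
    {s : Set ℕ} (hs : s = Set.range fun l => 2 * l + e) :
    ConvergesInLaw (fun n => P (2 * n + e)) (fun n ω => fp (X (2 * n + e) ω))
      ((negBinomial 2 (1 - q))[|s]) := by
  have := isFiniteMeasure_negBinomial_two hq hq1
  have hs0 : negBinomial 2 (1 - q) s ≠ 0 := by
    have h1 : ({e} : Set ℕ) ⊆ s := by rw [hs]; rintro _ rfl; exact ⟨0, by simp⟩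
    refine (lt_of_lt_of_le ?_ (measure_mono h1)).ne'
    rw [negBinomial_two_singleton, ENNReal.ofReal_pos]
    have : 0 < 1 - q := by linarith
    positivity
  have hprob : IsProbabilityMeasure ((negBinomial 2 (1 - q))[|s]) := cond_isProbabilityMeasure hs0
  have hmeas : ∀ n, AEMeasurable (fun ω => fp (X (2 * n + e) ω)) (P (2 * n + e)) := fun n =>
    (Measurable.of_discrete (f := fp)).comp_aemeasurable (hX _).aemeasurable
  refine ⟨hprob, hmeas, aemeasurable_id, ?_⟩
  refine ProbabilityMeasure.tendsto_iff_forall_integral_tendsto.2 fun F => ?_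
  simp only [ProbabilityMeasure.coe_mk, Measure.map_id]
  rw [integral_cond_negBinomial_two hq hq1 hs (fun k => F.norm_coe_le_norm k)]
  refine (tendsto_integral_fp_of_lt_one hσ hq hq1 he hX (fun k => F.norm_coe_le_norm k)).congr
    fun n => ?_
  rw [integral_map (hmeas n) .of_discrete]

/-! ### The supercritical regime -/

/-- Without truncation the right side would be `(1 - u) (1 + u) ^ n`. -/
theorem sum_ballot_mul_pow (n m : ℕ) (hm : 2 * m ≤ n) (u : ℂ) :
    ∑ i ∈ Finset.range (m + 1), (ballot n (n - 2 * i) : ℂ) * u ^ i =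
      ∑ i ∈ Finset.range (m + 1), (n.choose i : ℂ) * u ^ i -
        u * ∑ i ∈ Finset.range m, (n.choose i : ℂ) * u ^ i := by
  induction m with
  | zero => simp [ballot_self]
  | succ m ih =>
    rw [Finset.sum_range_succ, ih (by lia), Finset.sum_range_succ _ (m + 1),
      Finset.sum_range_succ _ m]
    have h := ballot_add_choose n (n - 2 * (m + 1)) m (by lia)
    have h' : (ballot n (n - 2 * (m + 1)) : ℂ) = n.choose (m + 1) - n.choose m := by
      rw [eq_sub_iff_add_eq]; exact_mod_cast h
    rw [h']
    ring

/-- In the upper half of the binomial sum every power of `u` has norm at most `s ^ n`, and the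
coefficients sum to at most `2 ^ n`. -/
theorem norm_sum_choose_mul_pow_le {n a : ℕ} {u : ℂ} {s : ℝ} (hs : 0 ≤ s) (hs1 : s ≤ 1)
    (hu : ‖u‖ = s ^ 2) {d : ℕ} (had : n ≤ 2 * (a + d)) :
    ‖∑ i ∈ Finset.Ico a (n + 1), (n.choose i : ℂ) * u ^ (i + d)‖ ≤ (2 * s) ^ n := by
  calc ‖∑ i ∈ Finset.Ico a (n + 1), (n.choose i : ℂ) * u ^ (i + d)‖
      ≤ ∑ i ∈ Finset.Ico a (n + 1), (n.choose i : ℝ) * s ^ n := by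
        refine norm_sum_le_of_le _ fun i hi => ?_
        rw [norm_mul, norm_pow, hu, ← pow_mul, Complex.norm_natCast]
        have : n ≤ 2 * (i + d) := by
          have := (Finset.mem_Ico.1 hi).1; lia
        exact mul_le_mul_of_nonneg_left (pow_le_pow_of_le_one hs hs1 this) (Nat.cast_nonneg _)
    _ ≤ ∑ i ∈ Finset.range (n + 1), (n.choose i : ℝ) * s ^ n := by
        refine Finset.sum_le_sum_of_subset_of_nonneg ?_ fun i _ _ => by positivity
        intro i hi
        have := (Finset.mem_Ico.1 hi).2
        exact Finset.mem_range.2 this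
    _ = (2 * s) ^ n := by
        rw [← Finset.sum_mul, mul_pow]
        congr 1
        exact_mod_cast Nat.sum_range_choose n

theorem norm_sum_ballot_sub_le (n : ℕ) {u : ℂ} {s : ℝ} (hs : 0 ≤ s) (hs1 : s ≤ 1)
    (hu : ‖u‖ = s ^ 2) :
    ‖∑ i ∈ Finset.range (n / 2 + 1), (ballot n (n - 2 * i) : ℂ) * u ^ i -
      (1 + u) ^ n * (1 - u)‖ ≤ 2 * (2 * s) ^ n := by
  have hfull : (1 + u) ^ n = ∑ i ∈ Finset.range (n + 1), (n.choose i : ℂ) * u ^ i := by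
    rw [add_comm, add_pow]
    exact Finset.sum_congr rfl fun i _ => by rw [one_pow]; ring
  have h1 := Finset.sum_range_add_sum_Ico (fun i => (n.choose i : ℂ) * u ^ i)
    (show n / 2 + 1 ≤ n + 1 by lia)
  have h2 := Finset.sum_range_add_sum_Ico (fun i => (n.choose i : ℂ) * u ^ i)
    (show n / 2 ≤ n + 1 by lia)
  have h3 : ∑ i ∈ Finset.Ico (n / 2) (n + 1), (n.choose i : ℂ) * u ^ (i + 1) =
      u * ∑ i ∈ Finset.Ico (n / 2) (n + 1), (n.choose i : ℂ) * u ^ i := by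
    rw [Finset.mul_sum]
    exact Finset.sum_congr rfl fun i _ => by ring
  have e : ∑ i ∈ Finset.range (n / 2 + 1), (ballot n (n - 2 * i) : ℂ) * u ^ i -
      (1 + u) ^ n * (1 - u) =
      ∑ i ∈ Finset.Ico (n / 2) (n + 1), (n.choose i : ℂ) * u ^ (i + 1) -
        ∑ i ∈ Finset.Ico (n / 2 + 1) (n + 1), (n.choose i : ℂ) * u ^ (i + 0) := by
    rw [sum_ballot_mul_pow n (n / 2) (by lia), h3]
    simp only [add_zero]
    have h1' := h1.trans hfull.symm
    have h2' := h2.trans hfull.symm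
    rw [← eq_sub_iff_add_eq'] at h1' h2'
    rw [h1', h2']
    ring
  rw [e, two_mul]
  refine (norm_sub_le _ _).trans (add_le_add ?_ ?_)
  · exact norm_sum_choose_mul_pow_le hs hs1 hu (by lia)
  · exact norm_sum_choose_mul_pow_le hs hs1 hu (by lia)

/-- With `s = q⁻¹ ≠ 1`, the inequality `2s < 1 + s²` makes the truncation error negligible against
`(1 + s²) ^ n`. -/
theorem tendsto_sum_ballot_div {q : ℝ} (hq : 1 < q) {u : ℕ → ℂ} (hu : ∀ n, ‖u n‖ = q⁻¹ ^ 2) :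
    Tendsto (fun n => (∑ i ∈ Finset.range (n / 2 + 1), (ballot n (n - 2 * i) : ℂ) * u n ^ i) /
      ((1 + q⁻¹ ^ 2 : ℝ) : ℂ) ^ n - ((1 + u n) / ((1 + q⁻¹ ^ 2 : ℝ) : ℂ)) ^ n * (1 - u n))
      atTop (𝓝 0) := by
  have hq0 : 0 < q := by linarith
  have hρ : Tendsto (fun n : ℕ => 2 * (2 * q⁻¹ / (1 + q⁻¹ ^ 2)) ^ n) atTop (𝓝 0) := by
    rw [← mul_zero (2 : ℝ)]
    refine (tendsto_pow_atTop_nhds_zero_of_lt_one (by positivity) ?_).const_mul 2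
    rw [div_lt_one (by positivity)]
    have : q⁻¹ < 1 := inv_lt_one_of_one_lt₀ hq
    nlinarith
  refine squeeze_zero_norm (fun n => ?_) hρ
  have h := norm_sum_ballot_sub_le n (u := u n) (s := q⁻¹) (by positivity)
    (inv_lt_one_of_one_lt₀ hq).le (hu n)
  have hA0 : 0 < 1 + q⁻¹ ^ 2 := by positivity
  rw [div_pow, div_mul_eq_mul_div, ← sub_div, norm_div, norm_pow, Complex.norm_real,
    Real.norm_of_nonneg hA0.le, div_pow, mul_div_assoc']
  gcongr

/-- The law of one step of the random walk that goes up with probability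
`q ^ 2 / (q ^ 2 + 1)` and down with probability `1 / (q ^ 2 + 1)`. -/
def stepLaw (q : ℝ) : Measure ℝ :=
  ENNReal.ofReal (q ^ 2 / (q ^ 2 + 1)) • Measure.dirac 1 +
    ENNReal.ofReal (1 / (q ^ 2 + 1)) • Measure.dirac (-1)

theorem isProbabilityMeasure_stepLaw (q : ℝ) : IsProbabilityMeasure (stepLaw q) := by
  refine ⟨?_⟩
  simp only [stepLaw, Measure.coe_add, Measure.coe_smul, Pi.add_apply, Pi.smul_apply,
    measure_univ, smul_eq_mul, mul_one]
  rw [← ENNReal.ofReal_add (by positivity) (by positivity), ← add_div, div_self (by positivity),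
    ENNReal.ofReal_one]

theorem integral_stepLaw {E : Type*} [NormedAddCommGroup E] [NormedSpace ℝ E] [CompleteSpace E]
    (q : ℝ) (F : ℝ → E) :
    ∫ x, F x ∂stepLaw q = (q ^ 2 / (q ^ 2 + 1)) • F 1 + (1 / (q ^ 2 + 1)) • F (-1) := by
  rw [stepLaw, integral_add_measure, integral_smul_measure, integral_smul_measure,
    integral_dirac, integral_dirac, ENNReal.toReal_ofReal (by positivity),
    ENNReal.toReal_ofReal (by positivity)]
  · exact (integrable_dirac (by simp)).smul_measure ENNReal.ofReal_ne_top
  · exact (integrable_dirac (by simp)).smul_measure ENNReal.ofReal_ne_top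

theorem tendsto_charFun_step {q : ℝ} (hq : 1 < q) (t : ℝ) :
    Tendsto (fun n : ℕ => (charFun ((stepLaw q).map fun x =>
      (x - (q ^ 2 - 1) / (q ^ 2 + 1)) / (2 * q / (q ^ 2 + 1))) ((√n)⁻¹ * t)) ^ n) atTop
      (𝓝 (Complex.exp (-t ^ 2 / 2))) := by
  have := isProbabilityMeasure_stepLaw q
  have hq0 : 0 < q := by linarith
  refine tendsto_charFun_inv_sqrt_mul_pow (by fun_prop) ?_ ?_ t
  · rw [integral_stepLaw]
    simp only [smul_eq_mul]
    field_simp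
    ring
  · simp only [Pi.pow_apply]
    rw [integral_stepLaw q (fun x => ((x - (q ^ 2 - 1) / (q ^ 2 + 1)) / (2 * q / (q ^ 2 + 1))) ^ 2)]
    simp only [smul_eq_mul]
    field_simp
    ring

/-- Pulling out the phase of an up-step leaves `1 + u` with `u = q⁻² exp (-2is)`, the base of the
power that dominates the generating function. -/
theorem charFun_stepLaw {q : ℝ} (hq : 0 < q) (s : ℝ) :
    charFun ((stepLaw q).map fun x =>
      (x - (q ^ 2 - 1) / (q ^ 2 + 1)) / (2 * q / (q ^ 2 + 1))) (s * (2 * q / (q ^ 2 + 1))) =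
      Complex.exp ((s * (1 - (q ^ 2 - 1) / (q ^ 2 + 1)) : ℝ) * Complex.I) *
        ((1 + (q⁻¹ ^ 2 : ℝ) * Complex.exp ((-2 * s : ℝ) * Complex.I)) /
          ((1 + q⁻¹ ^ 2 : ℝ) : ℂ)) := by
  rw [charFun_apply_real, integral_map (by fun_prop) (by fun_prop), integral_stepLaw]
  have e : ∀ x : ℝ, ((s * (2 * q / (q ^ 2 + 1)) : ℝ) : ℂ) *
      (((x - (q ^ 2 - 1) / (q ^ 2 + 1)) / (2 * q / (q ^ 2 + 1)) : ℝ) : ℂ) * Complex.I =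
      (s * (x - (q ^ 2 - 1) / (q ^ 2 + 1)) : ℝ) * Complex.I := fun x => by
    rw [← Complex.ofReal_mul]
    congr 2
    field_simp
  rw [e, e, show s * (-1 - (q ^ 2 - 1) / (q ^ 2 + 1)) =
    s * (1 - (q ^ 2 - 1) / (q ^ 2 + 1)) + (-2 * s) by ring, Complex.ofReal_add (s * _), add_mul,
    Complex.exp_add, Complex.real_smul, Complex.real_smul]
  have hq1 : (q : ℂ) ≠ 0 := by exact_mod_cast hq.ne'
  have hq2 : (q : ℂ) ^ 2 + 1 ≠ 0 := by exact_mod_cast (by positivity : q ^ 2 + 1 ≠ 0)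
  generalize Complex.exp _ = a
  generalize Complex.exp _ = b
  push_cast
  have e3 : (1 + (q : ℂ)⁻¹ ^ 2) = (q ^ 2 + 1) / q ^ 2 := by field_simp
  rw [e3]
  field_simp

/-- With `n - 2i` fixed points the centred value is `n (1 - m) - 2i`, so the phase splits into an
`n`-th power and an `i`-th power absorbed into `u`; the factor `q ^ n` cancels. -/
theorem integral_exp_fp {σ : Equiv.Perm (Fin 3)}
    (hσ : σ = pattern321 ∨ σ = pattern132 ∨ σ = pattern213) {q : ℝ} (hq : 0 < q) {n : ℕ}
    {Ω : Type*} [MeasurableSpace Ω] {P : Measure Ω}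
    {X : Ω → AvoidingInvolution σ n} (hX : HasLaw X (biasedMeasure q σ n) P) (s m : ℝ) :
    ∫ ω, Complex.exp ((s * ((fp (X ω) : ℝ) - m * n) : ℝ) * Complex.I) ∂P =
      Complex.exp ((s * (1 - m) : ℝ) * Complex.I) ^ n *
        (∑ i ∈ Finset.range (n / 2 + 1), (ballot n (n - 2 * i) : ℂ) *
          ((q⁻¹ ^ 2 : ℝ) * Complex.exp ((-2 * s : ℝ) * Complex.I)) ^ i) /
        ∑ i ∈ Finset.range (n / 2 + 1), (ballot n (n - 2 * i) : ℂ) * ((q⁻¹ ^ 2 : ℝ) : ℂ) ^ i := by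
  have hqC : (q : ℂ) ≠ 0 := by exact_mod_cast hq.ne'
  have hpow : ∀ i ∈ Finset.range (n / 2 + 1),
      (q : ℂ) ^ (n - 2 * i) = q ^ n * ((q⁻¹ ^ 2 : ℝ) : ℂ) ^ i := by
    intro i hi
    have hi' : 2 * i ≤ n := by have := Finset.mem_range.1 hi; lia
    rw [pow_sub₀ _ hqC hi', pow_mul]
    push_cast
    rw [inv_pow, inv_pow]
  have hZ : (partitionFunction q n : ℂ) = q ^ n *
      ∑ i ∈ Finset.range (n / 2 + 1), (ballot n (n - 2 * i) : ℂ) * ((q⁻¹ ^ 2 : ℝ) : ℂ) ^ i := by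
    rw [partitionFunction, Complex.ofReal_sum, Finset.mul_sum]
    refine Finset.sum_congr rfl fun i hi => ?_
    rw [Complex.ofReal_mul, Complex.ofReal_pow, hpow i hi, Complex.ofReal_natCast]
    ring
  rw [integral_fp hσ hq hX (fun k => Complex.exp ((s * ((k : ℝ) - m * n) : ℝ) * Complex.I)),
    Complex.real_smul, Complex.ofReal_inv, hZ]
  have hS : ∑ i ∈ Finset.range (n / 2 + 1), ((ballot n (n - 2 * i) : ℝ) * q ^ (n - 2 * i)) •
      Complex.exp ((s * (((n - 2 * i : ℕ) : ℝ) - m * n) : ℝ) * Complex.I) =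
      q ^ n * (Complex.exp ((s * (1 - m) : ℝ) * Complex.I) ^ n *
        ∑ i ∈ Finset.range (n / 2 + 1), (ballot n (n - 2 * i) : ℂ) *
          ((q⁻¹ ^ 2 : ℝ) * Complex.exp ((-2 * s : ℝ) * Complex.I)) ^ i) := by
    rw [Finset.mul_sum, Finset.mul_sum]
    refine Finset.sum_congr rfl fun i hi => ?_
    have hi' : 2 * i ≤ n := by have := Finset.mem_range.1 hi; lia
    rw [Complex.real_smul, Complex.ofReal_mul, Complex.ofReal_pow, hpow i hi,
      Complex.ofReal_natCast, mul_pow, ← Complex.exp_nat_mul, ← Complex.exp_nat_mul,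
      show ((s * (((n - 2 * i : ℕ) : ℝ) - m * n) : ℝ) : ℂ) * Complex.I =
        n * ((s * (1 - m) : ℝ) * Complex.I) + i * ((-2 * s : ℝ) * Complex.I) by
        push_cast [Nat.cast_sub hi']; ring, Complex.exp_add]
    ring
  rw [hS, mul_inv, mul_mul_mul_comm, inv_mul_cancel₀ (pow_ne_zero _ hqC), one_mul]
  ring

theorem convergesInLaw_of_one_lt {σ : Equiv.Perm (Fin 3)}
    (hσ : σ = pattern321 ∨ σ = pattern132 ∨ σ = pattern213) {q : ℝ} (hq : 1 < q)
    {Ω : ℕ → Type*} [∀ n, MeasurableSpace (Ω n)] {P : ∀ n, Measure (Ω n)}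
    [∀ n, IsProbabilityMeasure (P n)]
    {X : ∀ n, Ω n → AvoidingInvolution σ n} (hX : ∀ n, HasLaw (X n) (biasedMeasure q σ n) (P n)) :
    ConvergesInLaw P
      (fun n ω => ((fp (X n ω) : ℝ) - (q ^ 2 - 1) / (q ^ 2 + 1) * n) /
        √(4 * q ^ 2 / (q ^ 2 + 1) ^ 2 * n)) (gaussianReal 0 1) := by
  have hq0 : 0 < q := by linarith
  have hmeas : ∀ n, AEMeasurable (fun ω => ((fp (X n ω) : ℝ) - (q ^ 2 - 1) / (q ^ 2 + 1) * n) /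
        √(4 * q ^ 2 / (q ^ 2 + 1) ^ 2 * n)) (P n) := fun n =>
    (Measurable.of_discrete (f := fun π : AvoidingInvolution σ n =>
      ((fp π : ℝ) - (q ^ 2 - 1) / (q ^ 2 + 1) * n) /
        √(4 * q ^ 2 / (q ^ 2 + 1) ^ 2 * n))).comp_aemeasurable (hX _).aemeasurable
  refine ⟨inferInstance, hmeas, aemeasurable_id, ?_⟩
  refine ProbabilityMeasure.tendsto_iff_tendsto_charFun.2 fun t => ?_
  simp only [ProbabilityMeasure.coe_mk, Measure.map_id, charFun_gaussianReal]
  set m := (q ^ 2 - 1) / (q ^ 2 + 1) with hm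
  set d := 2 * q / (q ^ 2 + 1) with hd
  have hd0 : 0 < d := by positivity
  have hsqrt : ∀ n : ℕ, √(4 * q ^ 2 / (q ^ 2 + 1) ^ 2 * n) = d * √n := fun n => by
    rw [Real.sqrt_mul (by positivity), show 4 * q ^ 2 / (q ^ 2 + 1) ^ 2 = d ^ 2 by
      rw [hd, div_pow]; ring, Real.sqrt_sq hd0.le]
  set s : ℕ → ℝ := fun n => (√n)⁻¹ * t / d with hs
  have hs0 : Tendsto s atTop (𝓝 0) := by
    have : Tendsto (fun n : ℕ => (√n)⁻¹) atTop (𝓝 0) :=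
      tendsto_inv_atTop_zero.comp (Real.tendsto_sqrt_atTop.comp tendsto_natCast_atTop_atTop)
    simpa using (this.mul_const t).div_const d
  set v : ℕ → ℂ := fun n => (q⁻¹ ^ 2 : ℝ) * Complex.exp ((-2 * s n : ℝ) * Complex.I) with hv
  have hvn : ∀ n, ‖v n‖ = q⁻¹ ^ 2 := fun n => by
    rw [hv, norm_mul, Complex.norm_exp_ofReal_mul_I, mul_one, Complex.norm_real,
      Real.norm_of_nonneg (by positivity)]
  have hvlim : Tendsto v atTop (𝓝 ((q⁻¹ ^ 2 : ℝ) : ℂ)) := by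
    have hc : Continuous fun x : ℝ => ((q⁻¹ ^ 2 : ℝ) : ℂ) *
      Complex.exp ((-2 * x : ℝ) * Complex.I) := by fun_prop
    have := (hc.tendsto 0).comp hs0
    rwa [mul_zero, Complex.ofReal_zero, zero_mul, Complex.exp_zero, mul_one] at this
  have hden := tendsto_sum_ballot_div hq (u := fun _ => ((q⁻¹ ^ 2 : ℝ) : ℂ)) (fun _ => by
    rw [Complex.norm_real, Real.norm_of_nonneg (by positivity)])
  have hnum := tendsto_sum_ballot_div hq hvn
  have hstep := tendsto_charFun_step hq t
  have hcn : ∀ n : ℕ, charFun ((stepLaw q).map fun x => (x - m) / d) ((√n)⁻¹ * t) =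
      Complex.exp ((s n * (1 - m) : ℝ) * Complex.I) *
        ((1 + v n) / ((1 + q⁻¹ ^ 2 : ℝ) : ℂ)) := fun n => by
    rw [← charFun_stepLaw hq0, ← hd, hs]
    dsimp only
    rw [div_mul_cancel₀ _ hd0.ne']
  have hA : ((1 + q⁻¹ ^ 2 : ℝ) : ℂ) ≠ 0 := by
    exact_mod_cast (by positivity : (1 + q⁻¹ ^ 2 : ℝ) ≠ 0)
  have hr : (1 - ((q⁻¹ ^ 2 : ℝ) : ℂ)) ≠ 0 := by
    have h1 : q⁻¹ ^ 2 < 1 := pow_lt_one₀ (by positivity) (inv_lt_one_of_one_lt₀ hq) two_ne_zero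
    have h2 : (1 - q⁻¹ ^ 2 : ℝ) ≠ 0 := by linarith
    exact_mod_cast h2
  have hden' : Tendsto (fun n => (∑ i ∈ Finset.range (n / 2 + 1), (ballot n (n - 2 * i) : ℂ) *
      ((q⁻¹ ^ 2 : ℝ) : ℂ) ^ i) / ((1 + q⁻¹ ^ 2 : ℝ) : ℂ) ^ n) atTop
      (𝓝 (1 - ((q⁻¹ ^ 2 : ℝ) : ℂ))) := by
    have := hden.add_const (1 - ((q⁻¹ ^ 2 : ℝ) : ℂ))
    rw [zero_add] at this
    refine this.congr fun n => ?_
    have e : (1 + ((q⁻¹ ^ 2 : ℝ) : ℂ)) / ((1 + q⁻¹ ^ 2 : ℝ) : ℂ) = 1 := by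
      rw [div_eq_one_iff_eq hA]; push_cast; ring
    rw [e]
    ring
  have hnum' : Tendsto (fun n => Complex.exp ((s n * (1 - m) : ℝ) * Complex.I) ^ n *
      ((∑ i ∈ Finset.range (n / 2 + 1), (ballot n (n - 2 * i) : ℂ) * v n ^ i) /
        ((1 + q⁻¹ ^ 2 : ℝ) : ℂ) ^ n)) atTop
      (𝓝 (Complex.exp (-t ^ 2 / 2) * (1 - ((q⁻¹ ^ 2 : ℝ) : ℂ)))) := by
    -- The phase has modulus one, so multiplying the vanishing error by it is harmless.
    have h1 : Tendsto (fun n => Complex.exp ((s n * (1 - m) : ℝ) * Complex.I) ^ n *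
      ((∑ i ∈ Finset.range (n / 2 + 1), (ballot n (n - 2 * i) : ℂ) * v n ^ i) /
        ((1 + q⁻¹ ^ 2 : ℝ) : ℂ) ^ n - ((1 + v n) / ((1 + q⁻¹ ^ 2 : ℝ) : ℂ)) ^ n * (1 - v n)))
        atTop (𝓝 0) := by
      rw [tendsto_zero_iff_norm_tendsto_zero] at hnum ⊢
      refine hnum.congr fun n => ?_
      rw [norm_mul, norm_pow, Complex.norm_exp_ofReal_mul_I, one_pow, one_mul]
    have h2 := h1.add (hstep.mul (hvlim.const_sub 1))
    rw [zero_add] at h2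
    refine h2.congr fun n => ?_
    rw [hcn, mul_pow]
    ring
  have hfin := hnum'.div hden' hr
  rw [mul_div_cancel_right₀ _ hr] at hfin
  have e0 : Complex.exp (-t ^ 2 / 2) = Complex.exp (t * (0 : ℝ) * Complex.I -
      ((1 : NNReal) : ℝ) * t ^ 2 / 2) := by
    congr 1; simp; ring
  rw [e0] at hfin
  refine hfin.congr fun n => ?_
  rw [charFun_apply_real, integral_map (hmeas n) (by fun_prop)]
  have e1 : ∀ ω, (t : ℂ) * ((((fp (X n ω) : ℝ) - m * n) / √(4 * q ^ 2 / (q ^ 2 + 1) ^ 2 * n) : ℝ) :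
      ℂ) * Complex.I = (s n * ((fp (X n ω) : ℝ) - m * n) : ℝ) * Complex.I := fun ω => by
    rw [← Complex.ofReal_mul, hsqrt, hs]
    congr 2
    rw [div_eq_mul_inv, mul_inv]
    ring
  simp only [e1]
  rw [integral_exp_fp hσ hq0 (hX n)]
  rw [Pi.div_apply, mul_div_assoc', div_div_div_cancel_right₀ (pow_ne_zero _ hA)]

/-! ### The spacing of the eigenvalues of the traceless `2 × 2` ensemble -/

/-- The gap between the roots of a quadratic is the square root of its discriminant. -/
theorem altEigenvalueSum_two {M : Matrix (Fin 2) (Fin 2) ℝ} (hM : M.IsHermitian) :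
    altEigenvalueSum M = √(M.trace ^ 2 - 4 * M.det) := by
  set a := hM.eigenvalues₀ (Fin.cast (Fintype.card_fin 2).symm 0) with ha
  set b := hM.eigenvalues₀ (Fin.cast (Fintype.card_fin 2).symm 1) with hb
  have hab : b ≤ a := hM.eigenvalues₀_antitone (by simp)
  have htr : M.trace = a + b := by
    have h := hM.trace_eq_sum_eigenvalues
    have h2 : ∑ i, hM.eigenvalues i = ∑ j : Fin 2,
        hM.eigenvalues₀ (Fin.cast (Fintype.card_fin 2).symm j) :=
      (Equiv.sum_comp (Fintype.equivOfCardEq (Fintype.card_fin _)).symm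
        (fun k => hM.eigenvalues₀ k)).trans (Equiv.sum_comp (finCongr (Fintype.card_fin 2).symm)
          (fun k => hM.eigenvalues₀ k)).symm
    exact h.trans (h2.trans (Fin.sum_univ_two _))
  have hdet : M.det = a * b := by
    have h := hM.det_eq_prod_eigenvalues
    have h2 : ∏ i, hM.eigenvalues i = ∏ j : Fin 2,
        hM.eigenvalues₀ (Fin.cast (Fintype.card_fin 2).symm j) :=
      (Equiv.prod_comp (Fintype.equivOfCardEq (Fintype.card_fin _)).symm
        (fun k => hM.eigenvalues₀ k)).trans (Equiv.prod_comp (finCongr (Fintype.card_fin 2).symm)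
          (fun k => hM.eigenvalues₀ k)).symm
    exact h.trans (h2.trans (Fin.prod_univ_two _))
  rw [altEigenvalueSum, dif_pos hM, Fin.sum_univ_two, htr, hdet,
    show (a + b) ^ 2 - 4 * (a * b) = (a - b) ^ 2 by ring, Real.sqrt_sq (by linarith)]
  simp only [← ha, ← hb]
  simp
  ring

theorem altEigenvalueSum_goeTraceZero_two (g : Fin 2 × Fin 2 → ℝ) :
    1 / √2 * altEigenvalueSum (goeTraceZero 2 g) =
      √(((√2)⁻¹ * g (0, 0) + -(√2)⁻¹ * g (1, 1)) ^ 2 +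
        ((√2)⁻¹ * g (0, 1) + (√2)⁻¹ * g (1, 0)) ^ 2) := by
  have hM : (goeTraceZero 2 g).IsHermitian := by
    ext i j
    fin_cases i <;> fin_cases j <;> simp [goeTraceZero, goe, add_comm]
  have h2 : (√2) ^ 2 = 2 := Real.sq_sqrt (by norm_num)
  rw [altEigenvalueSum_two hM, ← Real.sqrt_one, ← Real.sqrt_div (by norm_num),
    ← Real.sqrt_mul (by norm_num)]
  congr 1
  rw [show ((√2)⁻¹ * g (0, 0) + -(√2)⁻¹ * g (1, 1)) ^ 2 +
        ((√2)⁻¹ * g (0, 1) + (√2)⁻¹ * g (1, 0)) ^ 2 =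
      ((√2) ^ 2)⁻¹ * ((g (0, 0) - g (1, 1)) ^ 2 + (g (0, 1) + g (1, 0)) ^ 2) by
    rw [← inv_pow]; ring, h2]
  simp [goeTraceZero, goe, Matrix.trace_fin_two, Matrix.det_fin_two]
  ring

theorem map_prod_gaussianArray_two :
    (gaussianArray 2).map (fun g => ((√2)⁻¹ * g (0, 0) + -(√2)⁻¹ * g (1, 1),
      (√2)⁻¹ * g (0, 1) + (√2)⁻¹ * g (1, 0))) = (gaussianReal 0 1).prod (gaussianReal 0 1) := by
  have hind : iIndepFun (fun (p : Fin 2 × Fin 2) (g : Fin 2 × Fin 2 → ℝ) => g p)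
      (gaussianArray 2) :=
    iIndepFun_pi (X := fun _ => id) (fun _ => aemeasurable_id)
  have hlaw : ∀ p : Fin 2 × Fin 2,
      HasLaw (fun g : Fin 2 × Fin 2 → ℝ => g p) (gaussianReal 0 1) (gaussianArray 2) := fun p =>
    (measurePreserving_eval (fun _ : Fin 2 × Fin 2 => gaussianReal 0 1) p).hasLaw
  have : IsProbabilityMeasure (gaussianArray 2) := hind.isProbabilityMeasure
  have hsum : ∀ (p r : Fin 2 × Fin 2) (c d : ℝ), p ≠ r → c ^ 2 + d ^ 2 = 1 →
      (gaussianArray 2).map (fun g => c * g p + d * g r) = gaussianReal 0 1 := by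
    intro p r c d hpr hcd
    have h1 := gaussianReal_const_mul (hlaw p) c
    have h2 := gaussianReal_const_mul (hlaw r) d
    have h3 : IndepFun (fun g : Fin 2 × Fin 2 → ℝ => c * g p) (fun g => d * g r)
        (gaussianArray 2) := (hind.indepFun hpr).comp (measurable_const_mul c)
          (measurable_const_mul d)
    have h4 := gaussianReal_add_gaussianReal_of_indepFun h3 h1.map_eq h2.map_eq
    rw [← show gaussianReal (c * 0 + d * 0) (.mk (c ^ 2) (sq_nonneg _) * 1 +
      .mk (d ^ 2) (sq_nonneg _) * 1) = gaussianReal 0 1 by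
        congr 1
        · simp
        · ext; simpa using hcd]
    exact h4
  have hc : (√2)⁻¹ ^ 2 = 2⁻¹ := by rw [inv_pow, Real.sq_sqrt (by norm_num)]
  have hUV : IndepFun (fun g : Fin 2 × Fin 2 → ℝ => (√2)⁻¹ * g (0, 0) + -(√2)⁻¹ * g (1, 1))
      (fun g => (√2)⁻¹ * g (0, 1) + (√2)⁻¹ * g (1, 0)) (gaussianArray 2) := by
    have h := hind.indepFun_prodMk_prodMk (fun p => measurable_pi_apply p) (0, 0) (1, 1) (0, 1)
      (1, 0) (by decide) (by decide) (by decide) (by decide)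
    exact h.comp (φ := fun x : ℝ × ℝ => (√2)⁻¹ * x.1 + -(√2)⁻¹ * x.2)
      (ψ := fun x : ℝ × ℝ => (√2)⁻¹ * x.1 + (√2)⁻¹ * x.2) (by fun_prop) (by fun_prop)
  rw [(indepFun_iff_map_prod_eq_prod_map_map (by fun_prop) (by fun_prop)).1 hUV,
    hsum _ _ _ _ (by decide) (by rw [neg_sq, hc]; norm_num),
    hsum _ _ _ _ (by decide) (by rw [hc]; norm_num)]

theorem measurable_rayleigh_density : Measurable fun x : ℝ =>
    ENNReal.ofReal (if 0 < x then x / 1 ^ 2 * Real.exp (-x ^ 2 / (2 * 1 ^ 2)) else 0) := by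
  refine ENNReal.measurable_ofReal.comp ?_
  exact Measurable.ite measurableSet_Ioi (by fun_prop) measurable_const

/-- In polar coordinates the Jacobian `r` supplies the Rayleigh density, and the angle integrates to
one. -/
theorem map_sqrt_gaussian_prod :
    ((gaussianReal 0 1).prod (gaussianReal 0 1)).map (fun p : ℝ × ℝ => √(p.1 ^ 2 + p.2 ^ 2)) =
      rayleigh 1 := by
  refine Measure.ext_of_lintegral _ fun h hh => ?_
  have hpdf := measurable_gaussianPDF 0 1
  rw [lintegral_map hh (by fun_prop), gaussianReal_of_var_ne_zero 0 one_ne_zero,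
    prod_withDensity_left hpdf, prod_withDensity_right hpdf,
    lintegral_withDensity_eq_lintegral_mul _ (by fun_prop) (by fun_prop),
    lintegral_withDensity_eq_lintegral_mul _ (by fun_prop) (by fun_prop), ← Measure.volume_eq_prod,
    ← lintegral_comp_polarCoord_symm]
  have hpt : ∀ p ∈ polarCoord.target, ENNReal.ofReal p.1 •
      ((fun z : ℝ × ℝ => gaussianPDF 0 1 z.2) * ((fun z : ℝ × ℝ => gaussianPDF 0 1 z.1) *
        fun a : ℝ × ℝ => h √(a.1 ^ 2 + a.2 ^ 2))) (polarCoord.symm p) =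
      (ENNReal.ofReal (p.1 * Real.exp (-p.1 ^ 2 / 2)) * h p.1) *
        ENNReal.ofReal (2 * Real.pi)⁻¹ := by
    rintro ⟨r, θ⟩ ⟨hr, -⟩
    have hr' : 0 < r := hr
    have e1 : (r * Real.cos θ) ^ 2 + (r * Real.sin θ) ^ 2 = r ^ 2 := by
      have := Real.sin_sq_add_cos_sq θ
      nlinarith
    have e2 : Real.exp (-(r * Real.sin θ) ^ 2 / 2) * Real.exp (-(r * Real.cos θ) ^ 2 / 2) =
        Real.exp (-r ^ 2 / 2) := by
      rw [← Real.exp_add, ← e1]; congr 1; ring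
    have e3 : (√(2 * Real.pi))⁻¹ * (√(2 * Real.pi))⁻¹ = (2 * Real.pi)⁻¹ := by
      rw [← mul_inv, Real.mul_self_sqrt (by positivity)]
    simp only [polarCoord_symm_apply, Pi.mul_apply, gaussianPDF, gaussianPDFReal, e1,
      Real.sqrt_sq hr'.le, smul_eq_mul, sub_zero, NNReal.coe_one, mul_one]
    rw [← mul_assoc, ← mul_assoc, ← ENNReal.ofReal_mul hr'.le,
      ← ENNReal.ofReal_mul (by positivity), mul_right_comm _ (h r),
      ← ENNReal.ofReal_mul (by positivity)]
    congr 2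
    rw [← e2, ← e3]
    ring
  rw [setLIntegral_congr_fun polarCoord.open_target.measurableSet hpt, polarCoord_target,
    Measure.volume_eq_prod, ← Measure.prod_restrict,
    lintegral_prod_mul (f := fun r => ENNReal.ofReal (r * Real.exp (-r ^ 2 / 2)) * h r)
      (g := fun _ => ENNReal.ofReal (2 * Real.pi)⁻¹) (by fun_prop) (by fun_prop), lintegral_const, Measure.restrict_apply_univ,
    Real.volume_Ioo, ← ENNReal.ofReal_mul (by positivity), rayleigh,
    lintegral_withDensity_eq_lintegral_mul _ measurable_rayleigh_density hh,
    show (2 * Real.pi)⁻¹ * (Real.pi - -Real.pi) = 1 by field_simp; ring, ENNReal.ofReal_one, mul_one,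
    ← lintegral_indicator measurableSet_Ioi]
  congr 1
  ext x
  simp only [Set.indicator_apply, Set.mem_Ioi, Pi.mul_apply]
  split_ifs with hx
  · simp
  · simp

theorem measurable_altEigenvalueSum_goeTraceZero_two :
    Measurable fun g : Fin 2 × Fin 2 → ℝ => altEigenvalueSum (goeTraceZero 2 g) := by
  have h2 : (√2) ≠ 0 := by positivity
  have : (fun g : Fin 2 × Fin 2 → ℝ => altEigenvalueSum (goeTraceZero 2 g)) = fun g =>
      √2 * √(((√2)⁻¹ * g (0, 0) + -(√2)⁻¹ * g (1, 1)) ^ 2 +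
        ((√2)⁻¹ * g (0, 1) + (√2)⁻¹ * g (1, 0)) ^ 2) := by
    funext g
    rw [← altEigenvalueSum_goeTraceZero_two, ← mul_assoc, mul_one_div_cancel h2, one_mul]
  rw [this]
  fun_prop

/-- At `q = 1` the reweighting density is constantly `1`. -/
theorem map_lawX_two_one : (lawX 2 1).map (fun x => 1 / √2 * x) = rayleigh 1 := by
  have hX : lawX 2 1 = lawS 2 := by
    have : IsProbabilityMeasure (gaussianArray 2) := by
      unfold gaussianArray; infer_instance
    have : IsProbabilityMeasure (lawS 2) :=
      Measure.isProbabilityMeasure_map measurable_altEigenvalueSum_goeTraceZero_two.aemeasurable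
    simp [lawX]
  rw [hX, lawS, Measure.map_map (by fun_prop) measurable_altEigenvalueSum_goeTraceZero_two,
    ← map_sqrt_gaussian_prod, ← map_prod_gaussianArray_two,
    Measure.map_map (by fun_prop) (by fun_prop)]
  congr 1
  funext g
  exact altEigenvalueSum_goeTraceZero_two g

/-! ### The Rayleigh law -/

theorem rayleigh_Ioi {x : ℝ} (hx : 0 ≤ x) :
    rayleigh 1 (Set.Ioi x) = ENNReal.ofReal (Real.exp (-x ^ 2 / 2)) := by
  have hderiv : ∀ y ∈ Set.Ici x, HasDerivAt (fun y : ℝ => -Real.exp (-y ^ 2 / 2))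
      (y * Real.exp (-y ^ 2 / 2)) y := by
    intro y _
    have h1 : HasDerivAt (fun y : ℝ => -y ^ 2 / 2) (-y) y := by
      have := ((hasDerivAt_pow 2 y).neg).div_const 2
      convert! this using 1
      simp only [Nat.cast_ofNat, Nat.add_one_sub_one, pow_one]
      ring
    convert! h1.exp.neg using 1
    ring
  have hpos : ∀ y ∈ Set.Ioi x, 0 ≤ y * Real.exp (-y ^ 2 / 2) := fun y hy => by
    have : 0 < y := lt_of_le_of_lt hx hy
    positivity
  have hlim : Tendsto (fun y : ℝ => -Real.exp (-y ^ 2 / 2)) atTop (𝓝 0) := by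
    rw [← neg_zero]
    refine Tendsto.neg (Real.tendsto_exp_atBot.comp ?_)
    have : Tendsto (fun y : ℝ => y ^ 2 / 2) atTop atTop :=
      (tendsto_pow_atTop two_ne_zero).atTop_div_const (by norm_num)
    refine (tendsto_neg_atTop_atBot.comp this).congr fun y => ?_
    simp [neg_div]
  have hint := integrableOn_Ioi_deriv_of_nonneg' hderiv hpos hlim
  have hval := integral_Ioi_of_hasDerivAt_of_nonneg' hderiv hpos hlim
  rw [rayleigh, withDensity_apply _ measurableSet_Ioi]
  have e : ∀ y ∈ Set.Ioi x,
      ENNReal.ofReal (if 0 < y then y / 1 ^ 2 * Real.exp (-y ^ 2 / (2 * 1 ^ 2)) else 0) =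
        ENNReal.ofReal (y * Real.exp (-y ^ 2 / 2)) := fun y hy => by
    rw [if_pos (lt_of_le_of_lt hx hy)]
    simp
  rw [setLIntegral_congr_fun measurableSet_Ioi e, ← ofReal_integral_eq_lintegral_ofReal hint
    ((ae_restrict_iff' measurableSet_Ioi).2 (Eventually.of_forall hpos)), hval]
  simp

instance isProbabilityMeasure_rayleigh : IsProbabilityMeasure (rayleigh 1) := by
  rw [← map_sqrt_gaussian_prod]
  exact Measure.isProbabilityMeasure_map (by fun_prop)

/-! ### The critical regime -/

/-- Probability measures on the line converge weakly if their tails converge pointwise. -/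
theorem tendsto_of_tendsto_measureReal_Ioi {μ : ℕ → ProbabilityMeasure ℝ} {ν : ProbabilityMeasure ℝ}
    (h : ∀ x, Tendsto (fun n => (μ n : Measure ℝ).real (Set.Ioi x)) atTop
      (𝓝 ((ν : Measure ℝ).real (Set.Ioi x)))) : Tendsto μ atTop (𝓝 ν) := by
  refine (isPiSystem_Ioc_mem (Set.univ : Set ℝ)
    Set.univ).tendsto_probabilityMeasure_of_tendsto_of_mem ?_ ?_ ?_
  · rintro _ ⟨l, -, u, -, -, rfl⟩
    exact measurableSet_Ioc
  · intro u hu x hx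
    obtain ⟨ε, hε, hsub⟩ := Metric.isOpen_iff.1 hu x hx
    refine ⟨Set.Ioc (x - ε / 2) (x + ε / 2), ⟨_, trivial, _, trivial, by linarith, rfl⟩,
      Ioc_mem_nhds (by linarith) (by linarith), fun y hy => hsub ?_⟩
    rw [Metric.mem_ball, Real.dist_eq, abs_lt]
    constructor <;> linarith [hy.1, hy.2]
  · rintro _ ⟨l, -, u, -, hlu, rfl⟩
    have key : ∀ ρ : ProbabilityMeasure ℝ, ((ρ (Set.Ioc l u) : NNReal) : ℝ) =
        (ρ : Measure ℝ).real (Set.Ioi l) - (ρ : Measure ℝ).real (Set.Ioi u) := fun ρ => by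
      rw [← measureReal_sdiff (Set.Ioi_subset_Ioi hlu.le) measurableSet_Ioi, Set.Ioi_sdiff_Ioi]
      rfl
    rw [← NNReal.tendsto_coe]
    simp only [key]
    exact (h l).sub (h u)

theorem partitionFunction_one (n : ℕ) : partitionFunction 1 n = n.choose (n / 2) := by
  rw [← sum_ballot n (n / 2) (by lia), partitionFunction]
  simp

/-- Having `n - 2i > y` means `i ≤ (n - ⌊y⌋ - 1) / 2`, and `sum_ballot` collapses the sum. The bound
`⌊y⌋ + 1 ≤ n` keeps the truncated subtraction honest: beyond it the numerator would read `C(n, 0) =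
1` instead of `0`. -/
theorem measureReal_lt_fp {σ : Equiv.Perm (Fin 3)}
    (hσ : σ = pattern321 ∨ σ = pattern132 ∨ σ = pattern213) {n : ℕ} {Ω : Type*}
    [MeasurableSpace Ω] {P : Measure Ω} {X : Ω → AvoidingInvolution σ n}
    (hX : HasLaw X (biasedMeasure 1 σ n) P) {y : ℝ} (hy : 0 ≤ y) (hyn : ⌊y⌋₊ + 1 ≤ n) :
    P.real {ω | y < fp (X ω)} = (n.choose ((n - ⌊y⌋₊ - 1) / 2) : ℝ) / n.choose (n / 2) := by
  have h1 : P.real {ω | y < fp (X ω)} =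
      (biasedMeasure 1 σ n).real {π | y < (fp π : ℝ)} :=
    hX.measureReal_eq (p := fun π => y < (fp π : ℝ)) .of_discrete
  rw [h1, ← integral_indicator_one .of_discrete]
  have h2 := integral_fp_biasedMeasure hσ one_pos n (fun k : ℕ => if y < k then (1 : ℝ) else 0)
  have h3 : (fun π : AvoidingInvolution σ n => if y < (fp π : ℝ) then (1 : ℝ) else 0) =
      Set.indicator {π | y < (fp π : ℝ)} 1 := by
    funext π
    simp [Set.indicator_apply]
  rw [h3] at h2
  rw [h2, partitionFunction_one, smul_eq_mul, inv_mul_eq_div]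
  congr 1
  rw [← sum_ballot n _ (by lia : 2 * ((n - ⌊y⌋₊ - 1) / 2) ≤ n)]
  simp only [one_pow, mul_one, smul_eq_mul, mul_ite, mul_zero]
  rw [← Finset.sum_filter]
  refine Finset.sum_congr ?_ fun _ _ => rfl
  ext i
  simp only [Finset.mem_filter, Finset.mem_range, ← Nat.floor_lt hy]
  lia

theorem tendsto_natCast_div_two_div : Tendsto (fun n : ℕ => ((n / 2 : ℕ) : ℝ) / n) atTop
    (𝓝 (1 / 2)) := by
  have h1 : Tendsto (fun n : ℕ => (1 / 2 : ℝ) - 1 / n) atTop (𝓝 (1 / 2)) := by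
    simpa using tendsto_one_div_atTop_nhds_zero_nat.const_sub (1 / 2 : ℝ)
  refine tendsto_of_tendsto_of_tendsto_of_le_of_le' h1 tendsto_const_nhds ?_ ?_
  · filter_upwards [eventually_gt_atTop 0] with n hn
    have hn' : (0 : ℝ) < n := by exact_mod_cast hn
    have : (n : ℝ) ≤ 2 * (n / 2 : ℕ) + 2 := by exact_mod_cast (by lia : n ≤ 2 * (n / 2) + 2)
    rw [le_div_iff₀ hn', sub_mul, one_div_mul_cancel hn'.ne']
    linarith
  · filter_upwards [eventually_gt_atTop 0] with n hn
    have hn' : (0 : ℝ) < n := by exact_mod_cast hn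
    have : 2 * ((n / 2 : ℕ) : ℝ) ≤ n := by exact_mod_cast (by lia : 2 * (n / 2) ≤ n)
    rw [div_le_iff₀ hn']
    linarith

theorem tendsto_sqrt_natCast : Tendsto (fun n : ℕ => √(n : ℝ)) atTop atTop :=
  Real.tendsto_sqrt_atTop.comp tendsto_natCast_atTop_atTop

theorem tendsto_one_div_sqrt_natCast : Tendsto (fun n : ℕ => 1 / √(n : ℝ)) atTop (𝓝 0) := by
  simp only [one_div]
  exact tendsto_inv_atTop_zero.comp tendsto_sqrt_natCast

theorem eventually_floor_mul_sqrt_add_one_le {x : ℝ} (hx : 0 ≤ x) :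
    ∀ᶠ n : ℕ in atTop, ⌊x * √n⌋₊ + 1 ≤ n := by
  have h1 := ((tendsto_nat_floor_mul_div_atTop hx).comp tendsto_sqrt_natCast).mul
    tendsto_one_div_sqrt_natCast
  rw [mul_zero] at h1
  filter_upwards [h1.eventually_lt_const one_pos, eventually_gt_atTop 0] with n hn hn0
  have hn' : (0 : ℝ) < n := by exact_mod_cast hn0
  rw [Function.comp_apply, div_mul_div_comm, mul_one, Real.mul_self_sqrt hn'.le,
    div_lt_one hn'] at hn
  exact_mod_cast hn

/-- The lower index lies `s ~ x √n / 2` below the middle, and both exponential bounds have exponent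
`-s² / (n / 2) → -x² / 2`. -/
theorem tendsto_choose_div_choose {x : ℝ} (hx : 0 ≤ x) :
    Tendsto (fun n : ℕ => (n.choose ((n - ⌊x * √n⌋₊ - 1) / 2) : ℝ) / n.choose (n / 2)) atTop
      (𝓝 (Real.exp (-x ^ 2 / 2))) := by
  set K : ℕ → ℕ := fun n => ⌊x * √n⌋₊ with hK
  set s : ℕ → ℕ := fun n => n / 2 - (n - K n - 1) / 2 with hs
  have hw := tendsto_sqrt_natCast
  have hw1 := tendsto_one_div_sqrt_natCast
  have hKlim : Tendsto (fun n : ℕ => (K n : ℝ) / √n) atTop (𝓝 x) :=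
    (tendsto_nat_floor_mul_div_atTop hx).comp hw
  have hKn : ∀ᶠ n in atTop, K n + 1 ≤ n := eventually_floor_mul_sqrt_add_one_le hx
  have hslim : Tendsto (fun n : ℕ => (s n : ℝ) / √n) atTop (𝓝 (x / 2)) := by
    have hl : Tendsto (fun n : ℕ => (K n : ℝ) / √n / 2) atTop (𝓝 (x / 2)) := hKlim.div_const 2
    have hu : Tendsto (fun n : ℕ => (K n : ℝ) / √n / 2 + 1 / √n) atTop (𝓝 (x / 2)) := by
      simpa using hl.add hw1
    refine tendsto_of_tendsto_of_tendsto_of_le_of_le' hl hu ?_ ?_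
    · filter_upwards [hKn] with n hn
      have : (K n : ℝ) ≤ 2 * s n := by
        exact_mod_cast (by simp only [hs]; lia : K n ≤ 2 * s n)
      rw [div_right_comm]
      gcongr
      linarith
    · filter_upwards [hKn] with n hn
      have : 2 * (s n : ℝ) ≤ K n + 2 := by
        exact_mod_cast (by simp only [hs]; lia : 2 * s n ≤ K n + 2)
      rw [div_right_comm, ← add_div]
      gcongr
      linarith
  have hclim := tendsto_natCast_div_two_div
  have hdlim : Tendsto (fun n : ℕ => ((n : ℝ) - 2 * (n / 2 : ℕ)) * (1 / √n)) atTop (𝓝 0) := by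
    refine squeeze_zero' ?_ ?_ hw1
    · refine Eventually.of_forall fun n => ?_
      have : 2 * ((n / 2 : ℕ) : ℝ) ≤ n := by exact_mod_cast (by lia : 2 * (n / 2) ≤ n)
      exact mul_nonneg (by linarith) (by positivity)
    · refine Eventually.of_forall fun n => ?_
      have : (n : ℝ) ≤ 2 * (n / 2 : ℕ) + 1 := by exact_mod_cast (by lia : n ≤ 2 * (n / 2) + 1)
      exact mul_le_of_le_one_left (by positivity) (by linarith)
  have hlow : Tendsto (fun n : ℕ => Real.exp (-((s n : ℝ) ^ 2 +
      (n - 2 * (n / 2 : ℕ)) * s n) / ((n / 2 : ℕ) + 1 - s n))) atTop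
      (𝓝 (Real.exp (-x ^ 2 / 2))) := by
    refine (Real.continuous_exp.tendsto _).comp ?_
    have h1 := ((hslim.pow 2).add (hdlim.mul hslim)).neg.div
      ((hclim.add (hw1.pow 2)).sub (hslim.mul hw1)) (by norm_num)
    have e : -((x / 2) ^ 2 + 0 * (x / 2)) / (1 / 2 + 0 ^ 2 - x / 2 * 0) = -x ^ 2 / 2 := by ring
    rw [e] at h1
    refine h1.congr' ?_
    filter_upwards [eventually_gt_atTop 0] with n hn0
    have hn' : (0 : ℝ) < n := by exact_mod_cast hn0
    have hw0 : 0 < √(n : ℝ) := Real.sqrt_pos.2 hn'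
    have hwn : (n : ℝ) = √n ^ 2 := (Real.sq_sqrt hn'.le).symm
    rw [Pi.div_apply, ← div_div_div_cancel_right₀ hn'.ne' (-((s n : ℝ) ^ 2 + _))]
    generalize √(n : ℝ) = w at hw0 hwn ⊢
    congr 1
    · rw [hwn]; field_simp
    · rw [hwn]; field_simp
  have hupp : Tendsto (fun n : ℕ => Real.exp (-(s n : ℝ) ^ 2 / (n - (n / 2 : ℕ) + s n))) atTop
      (𝓝 (Real.exp (-x ^ 2 / 2))) := by
    refine (Real.continuous_exp.tendsto _).comp ?_
    have h1 := (hslim.pow 2).neg.div ((hclim.const_sub 1).add (hslim.mul hw1)) (by norm_num)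
    have e : -((x / 2) ^ 2) / (1 - 1 / 2 + x / 2 * 0) = -x ^ 2 / 2 := by ring
    rw [e] at h1
    refine h1.congr' ?_
    filter_upwards [eventually_gt_atTop 0] with n hn0
    have hn' : (0 : ℝ) < n := by exact_mod_cast hn0
    have hw0 : 0 < √(n : ℝ) := Real.sqrt_pos.2 hn'
    have hwn : (n : ℝ) = √n ^ 2 := (Real.sq_sqrt hn'.le).symm
    rw [Pi.div_apply, ← div_div_div_cancel_right₀ hn'.ne' (-(s n : ℝ) ^ 2)]
    generalize √(n : ℝ) = w at hw0 hwn ⊢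
    congr 1
    · rw [hwn]; field_simp
    · rw [hwn]; field_simp
  have hsub : ∀ n : ℕ, (n - K n - 1) / 2 = n / 2 - s n := fun n => by
    simp only [hs]; lia
  refine tendsto_of_tendsto_of_tendsto_of_le_of_le hlow hupp (fun n => ?_) (fun n => ?_)
  · have hpos : (0 : ℝ) < n.choose (n / 2) := by exact_mod_cast Nat.choose_pos (by lia)
    dsimp only
    rw [le_div_iff₀ hpos, mul_comm, hsub]
    exact choose_mul_exp_le_choose_sub (by lia) (by simp only [hs]; lia)
  · have hpos : (0 : ℝ) < n.choose (n / 2) := by exact_mod_cast Nat.choose_pos (by lia)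
    dsimp only
    rw [div_le_iff₀ hpos, mul_comm (Real.exp _), hsub]
    exact choose_sub_le_mul_exp (by lia) (by simp only [hs]; lia)

theorem convergesInLaw_one {σ : Equiv.Perm (Fin 3)}
    (hσ : σ = pattern321 ∨ σ = pattern132 ∨ σ = pattern213)
    {Ω : ℕ → Type*} [∀ n, MeasurableSpace (Ω n)] {P : ∀ n, Measure (Ω n)}
    [∀ n, IsProbabilityMeasure (P n)]
    {X : ∀ n, Ω n → AvoidingInvolution σ n} (hX : ∀ n, HasLaw (X n) (biasedMeasure 1 σ n) (P n)) :
    ConvergesInLaw P (fun n ω => √(1 / (n : ℝ)) * (fp (X n ω) : ℝ)) (rayleigh 1) := by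
  have hmeas : ∀ n : ℕ, AEMeasurable (fun ω => √(1 / (n : ℝ)) * (fp (X n ω) : ℝ)) (P n) := fun n =>
    (Measurable.of_discrete (f := fun π : AvoidingInvolution σ n =>
      √(1 / (n : ℝ)) * (fp π : ℝ))).comp_aemeasurable (hX _).aemeasurable
  refine ⟨inferInstance, hmeas, aemeasurable_id, tendsto_of_tendsto_measureReal_Ioi fun x => ?_⟩
  simp only [ProbabilityMeasure.coe_mk, Measure.map_id]
  have hmap : ∀ n : ℕ, ((P n).map fun ω => √(1 / (n : ℝ)) * (fp (X n ω) : ℝ)).real (Set.Ioi x) =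
      (P n).real {ω | x < √(1 / (n : ℝ)) * (fp (X n ω) : ℝ)} := fun n =>
    map_measureReal_apply_of_aemeasurable (hmeas n) measurableSet_Ioi
  simp only [hmap]
  rcases lt_or_ge x 0 with hx | hx
  -- For negative `x` both tails equal one, because the variable and its limit are nonnegative.
  · have h1 : (rayleigh 1).real (Set.Ioi x) = 1 := by
      refine le_antisymm measureReal_le_one ?_
      have h2 : (rayleigh 1).real (Set.Ioi 0) = 1 := by
        rw [measureReal_def, rayleigh_Ioi le_rfl]; simp
      exact h2.symm.le.trans (measureReal_mono (Set.Ioi_subset_Ioi hx.le))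
    rw [h1]
    refine tendsto_const_nhds.congr fun n => ?_
    have : {ω | x < √(1 / (n : ℝ)) * (fp (X n ω) : ℝ)} = Set.univ := by
      ext ω
      simp only [Set.mem_ofPred_eq, Set.mem_univ, iff_true]
      exact hx.trans_le (by positivity)
    rw [this, probReal_univ]
  · rw [measureReal_def, rayleigh_Ioi hx, ENNReal.toReal_ofReal (Real.exp_pos _).le]
    refine (tendsto_choose_div_choose hx).congr' ?_
    filter_upwards [eventually_floor_mul_sqrt_add_one_le hx, eventually_gt_atTop 0] with n hn hn0
    rw [← measureReal_lt_fp hσ (hX n) (by positivity) hn]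
    congr 1
    ext ω
    have hw0 : 0 < √(n : ℝ) := Real.sqrt_pos.2 (by exact_mod_cast hn0)
    simp only [Set.mem_ofPred_eq]
    rw [Real.sqrt_div zero_le_one, Real.sqrt_one, one_div_mul_eq_div, lt_div_iff₀ hw0]

end FixedPointBias

end

/-! ### The three regimes combined -/

open FixedPointBias in
theorem theorem3 (σ : Equiv.Perm (Fin 3))
    (hσ : σ = pattern321 ∨ σ = pattern132 ∨ σ = pattern213)
    (q : ℝ) (hq : 0 < q)
    {Ω : ℕ → Type*} [∀ n, MeasurableSpace (Ω n)] (P : ∀ n, Measure (Ω n))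
    [∀ n, IsProbabilityMeasure (P n)]
    (Pi : ∀ n, Ω n → AvoidingInvolution σ n)
    (hPi : ∀ n, HasLaw (Pi n) (biasedMeasure q σ n) (P n)) :
    (q < 1 →
      ConvergesInLaw (fun n => P (2 * n)) (fun n ω => fp (Pi (2 * n) ω))
        ((negBinomial 2 (1 - q))[|{k : ℕ | Even k}]) ∧
      ConvergesInLaw (fun n => P (2 * n + 1)) (fun n ω => fp (Pi (2 * n + 1) ω))
        ((negBinomial 2 (1 - q))[|{k : ℕ | Odd k}])) ∧
    (q = 1 →
      ConvergesInLaw P (fun n ω => √(1 / (n : ℝ)) * (fp (Pi n ω) : ℝ))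
        ((lawX 2 1).map fun x => 1 / √2 * x) ∧
      (lawX 2 1).map (fun x => 1 / √2 * x) = rayleigh 1) ∧
    (1 < q →
      ConvergesInLaw P
        (fun n ω => ((fp (Pi n ω) : ℝ) - (q ^ 2 - 1) / (q ^ 2 + 1) * n) /
          √(4 * q ^ 2 / (q ^ 2 + 1) ^ 2 * n))
        (gaussianReal 0 1)) := by
  refine ⟨fun hq1 => ⟨?_, ?_⟩, ?_, fun hq1 => convergesInLaw_of_one_lt hσ hq1 hPi⟩
  · refine convergesInLaw_of_lt_one (e := 0) hσ hq hq1 (by norm_num) hPi ?_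
    ext k
    exact ⟨fun ⟨r, hr⟩ => ⟨r, by dsimp only; lia⟩, fun ⟨l, hl⟩ => ⟨l, by dsimp only at hl; lia⟩⟩
  · refine convergesInLaw_of_lt_one (e := 1) hσ hq hq1 (by norm_num) hPi ?_
    ext k
    exact ⟨fun ⟨r, hr⟩ => ⟨r, hr.symm⟩, fun ⟨l, hl⟩ => ⟨l, hl.symm⟩⟩
  · rintro rfl
    rw [map_lawX_two_one]
    exact ⟨convergesInLaw_one hσ hPi, rfl⟩
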